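/- Let $n\ge 3$ and $m\ge 2$. Consider $n$ parties, party $i$ having $m$ measurement settings $s_i\in\{0,\dots,m-1\}$ with binary outcomes $r_i\in\{0,1\}$, and let $P(\vec r\,|\,\vec s)$ denote the joint outcome probabilities. Write $[X]_d\in\{0,\dots,d-1\}$ for the residue of $X$ modulo $d$, $|\vec s|=\sum_i s_i$, $|\vec r|=\sum_i r_i$, $P([|\vec r|]_2=r)$ for the probability, given the settings $\vec s$, that the sum of the outcomes is congruent to $r$ modulo 2, and let $$\Omega(n,m,2)=\sum_{\vec s:\,[|\vec s|]_m=0}\ \sum_{r=0}^{1}\Big[r-\Big\lfloor\tfrac{|\vec s|}{m}\Big\rfloor\Big]_2 P([|\vec r|]_2=r)+\sum_{\vec s:\,[|\vec s|]_m=1}\ \sum_{r=0}^{1}\Big[-r+\Big\lfloor\tfrac{|\vec s|}{m}\Big\rfloor\Big]_2 P([|\vec r|]_2=r).$$ Call $P$ a biseparable quantum correlation if there are complex Hilbert spaces $H_1,\dots,H_n$ (of arbitrary, possibly infinite, dimension), POVMs $(M^{i}_{0|t},M^{i}_{1|t})$ on $H_i$ for every party $i$ and setting $t$, and a biseparable state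 $\rho$ on $H_1\otimes\dots\otimes H_n$ with $P(\vec r\,|\,\vec s)=\operatorname{tr}\big(\rho\,M^{1}_{r_1|s_1}\otimes\dots\otimes M^{n}_{r_n|s_n}\big)$. Here a state is biseparable if it is a (finite, countable or continuous) probabilistic mixture of pure states each of which is a product $\alpha\otimes\beta$ across some partition of the $n$ parties into two nonempty groups; the partition may vary within the mixture. Then: 1. every biseparable quantum correlation satisfies $$\Omega(n,m,2)\ \ge\ m^{n-2}\Big(m-\cot\frac{\pi}{2m}\Big);$$ equivalently, a quantum correlation violating this inequality can only be obtained from a genuinely $n$-partite entangled state, whatever the Hilbert spaces and the measurements; 2. with $\eta_j=\gcd(2j+1,m)$, $$\max_{j=0,\dots,m-1}\ \eta_j\,\csc\frac{\eta_j\pi}{2m}\,\Big|\cos\frac{(2j+1)\pi}{2m}\Big|=\cot\frac{\pi}{2m},$$ and the maximum is attained at $j=0$. -/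

import Mathlib

universe u v

/-! ## Multipartite Hilbert spaces

Every complex Hilbert space is `ℓ²(d)` for some index type `d` of an orthonormal basis, and the
Hilbert-space tensor product of the `ℓ²(d i)` is `ℓ²(Π i, d i)`, the pure tensor `⨂ v i` being
`x ↦ ∏ i, v i (x i)`. No restriction is put on the (possibly infinite) dimensions. -/

/-- The complex Hilbert space with an orthonormal basis indexed by `d`. -/
abbrev HilbSp (d : Type*) : Type _ := lp (fun _ : d => ℂ) 2

section Ampliation

variable {ι : Type*} [DecidableEq ι] {d : ι → Type*}

/-- The slice of a multipartite vector in direction `i`: coordinates other than `i` are frozen. -/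
noncomputable def slice (i : ι) (ψ : HilbSp (∀ j, d j)) (y : ∀ j : {j // j ≠ i}, d j) :
    HilbSp (d i) :=
  ⟨fun t => ψ ((Equiv.piSplitAt i d).symm (t, y)), by
    have h := (lp.memℓp ψ).summable (by norm_num)
    refine memℓp_gen (h.comp_injective (i := fun t => (Equiv.piSplitAt i d).symm (t, y)) ?_)
    intro t t' e
    simpa using (Equiv.piSplitAt i d).symm.injective e⟩

theorem slice_add (i : ι) (ψ φ : HilbSp (∀ j, d j)) (y : ∀ j : {j // j ≠ i}, d j) :
    slice i (ψ + φ) y = slice i ψ y + slice i φ y := rfl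

theorem slice_smul (i : ι) (c : ℂ) (ψ : HilbSp (∀ j, d j)) (y : ∀ j : {j // j ≠ i}, d j) :
    slice i (c • ψ) y = c • slice i ψ y := rfl

/-- The squared norms of the images of the slices of a vector under a bounded operator,
written as a double sum over the coordinates. -/
theorem summable_ampliation (i : ι) (A : HilbSp (d i) →L[ℂ] HilbSp (d i))
    (ψ : HilbSp (∀ j, d j)) :
    (Summable fun x : ∀ j, d j => ‖A (slice i ψ fun j => x j) (x i)‖ ^ (2 : ENNReal).toReal) ∧
    ∑' x : ∀ j, d j, ‖A (slice i ψ fun j => x j) (x i)‖ ^ (2 : ENNReal).toReal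
      ≤ (‖A‖ * ‖ψ‖) ^ (2 : ENNReal).toReal := by
  have p0 : 0 < (2 : ENNReal).toReal := by norm_num
  let e := (Equiv.prodComm (∀ j : {j // j ≠ i}, d j) (d i)).trans (Equiv.piSplitAt i d).symm
  have hψ : HasSum (fun q : (∀ j : {j // j ≠ i}, d j) × d i => ‖ψ (e q)‖ ^ (2 : ENNReal).toReal)
      (‖ψ‖ ^ (2 : ENNReal).toReal) := (e.hasSum_iff).2 (lp.hasSum_norm p0 ψ)
  have hs : HasSum (fun y => ‖slice i ψ y‖ ^ (2 : ENNReal).toReal)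
      (‖ψ‖ ^ (2 : ENNReal).toReal) :=
    hψ.prod_fiberwise fun y => lp.hasSum_norm p0 (slice i ψ y)
  have hA : ∀ y, ‖A (slice i ψ y)‖ ^ (2 : ENNReal).toReal
      ≤ ‖A‖ ^ (2 : ENNReal).toReal * ‖slice i ψ y‖ ^ (2 : ENNReal).toReal := by
    intro y
    rw [← Real.mul_rpow (norm_nonneg _) (norm_nonneg _)]
    exact Real.rpow_le_rpow (norm_nonneg _) (A.le_opNorm _) p0.le
  have hAs : Summable fun y => ‖A (slice i ψ y)‖ ^ (2 : ENNReal).toReal :=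
    Summable.of_nonneg_of_le (fun y => Real.rpow_nonneg (norm_nonneg _) _) hA
      (hs.summable.mul_left _)
  have hfib : ∀ y, HasSum (fun t => ‖A (slice i ψ y) t‖ ^ (2 : ENNReal).toReal)
      (‖A (slice i ψ y)‖ ^ (2 : ENNReal).toReal) := fun y => lp.hasSum_norm p0 _
  have hprod : Summable fun q : (∀ j : {j // j ≠ i}, d j) × d i =>
      ‖A (slice i ψ q.1) q.2‖ ^ (2 : ENNReal).toReal := by
    rw [summable_prod_of_nonneg (fun q => Real.rpow_nonneg (norm_nonneg _) _)]
    exact ⟨fun y => (hfib y).summable, by simpa only [(hfib _).tsum_eq] using hAs⟩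
  have he : (fun q => ‖A (slice i ψ q.1) q.2‖ ^ (2 : ENNReal).toReal) =
      (fun x : ∀ j, d j => ‖A (slice i ψ fun j => x j) (x i)‖ ^ (2 : ENNReal).toReal) ∘ e := by
    funext q
    have h1 : (fun j : {j // j ≠ i} => e q j) = q.1 := by
      funext j
      simp [e, Equiv.piSplitAt, j.2]
    have h2 : e q i = q.2 := by simp [e, Equiv.piSplitAt]
    simp only [Function.comp, h1, h2]
  refine ⟨e.summable_iff.1 (he ▸ hprod), ?_⟩
  rw [← e.tsum_eq]
  have : ∑' q : (∀ j : {j // j ≠ i}, d j) × d i, ‖A (slice i ψ q.1) q.2‖ ^ (2 : ENNReal).toReal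
      = ∑' y, ‖A (slice i ψ y)‖ ^ (2 : ENNReal).toReal := by
    rw [hprod.tsum_prod]
    exact tsum_congr fun y => (hfib y).tsum_eq
  have h3 := congrArg tsum he
  simp only [Function.comp_def] at h3
  rw [← h3, this, Real.mul_rpow (norm_nonneg _) (norm_nonneg _), ← hs.tsum_eq, ← tsum_mul_left]
  exact hAs.tsum_le_tsum hA (hs.summable.mul_left _)

/-- The operator `A` acting on the `i`-th tensor factor, i.e. `1 ⊗ ⋯ ⊗ A ⊗ ⋯ ⊗ 1`:
`A` is applied to every slice in direction `i`. -/
noncomputable def ampliation (i : ι) (A : HilbSp (d i) →L[ℂ] HilbSp (d i)) :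
    HilbSp (∀ j, d j) →L[ℂ] HilbSp (∀ j, d j) :=
  LinearMap.mkContinuous
    { toFun := fun ψ => ⟨fun x => A (slice i ψ fun j => x j) (x i),
        memℓp_gen (summable_ampliation i A ψ).1⟩
      map_add' := fun ψ φ => by
        ext x
        simp [slice_add]
        rfl
      map_smul' := fun c ψ => by
        ext x
        simp [slice_smul] }
    ‖A‖ fun ψ => lp.norm_le_of_tsum_le (by norm_num) (by positivity)
      (summable_ampliation i A ψ).2

end Ampliation

/-! ## Measurements, biseparable states and biseparable correlations -/

/-- A quantum measurement (POVM) with `k` outcomes on the Hilbert space `ℓ²(d)`. -/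
structure POVM (k : ℕ) (d : Type*) where
  effect : Fin k → HilbSp d →L[ℂ] HilbSp d
  isPositive : ∀ r, (effect r).IsPositive
  sum_eq_one : ∑ r, effect r = 1

/-- `M_{r₁|s₁} ⊗ ⋯ ⊗ M_{rₙ|sₙ}`: the joint effect for the settings `s` and outcomes `r`. (The
factors act on different tensor factors and commute.) -/
noncomputable def jointEffect {n m k : ℕ} {d : Fin n → Type*}
    (M : ∀ i, Fin m → POVM k (d i)) (s : Fin n → Fin m) (r : Fin n → Fin k) :
    HilbSp (∀ i, d i) →L[ℂ] HilbSp (∀ i, d i) :=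
  (List.ofFn fun i => ampliation i ((M i (s i)).effect (r i))).prod

/-- An `n`-partite pure state is biseparable if it is a product `α ⊗ β` across some partition of
the parties into two nonempty groups `G` and `Gᶜ`. -/
def IsBiseparablePure {n : ℕ} {d : Fin n → Type*} (ψ : HilbSp (∀ i, d i)) : Prop :=
  ∃ G : Finset (Fin n), G.Nonempty ∧ Gᶜ.Nonempty ∧
    ∃ (α : HilbSp (∀ i : {i // i ∈ G}, d i)) (β : HilbSp (∀ i : {i // i ∉ G}, d i)),
      ∀ x : ∀ i, d i, ψ x = α (fun i => x i) * β (fun i => x i)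

/-- `P s r` (probability of the outcomes `r` given the settings `s`) is a biseparable quantum
correlation: there are Hilbert spaces `ℓ²(d i)`, POVMs `M i t`, and a biseparable mixed state, i.e.
a mixture `ρ = ∫ |ψ_l⟩⟨ψ_l| dμ(l)` of biseparable unit vectors (finite and countable mixtures being
the case of a discrete `μ`; the bipartition may depend on `l`), such that
`P s r = tr (ρ · ⨂ M_{r i|s i}) = ∫ ⟨ψ_l, (⨂ M_{r i|s i}) ψ_l⟩ dμ(l)`. -/
def IsBiseparableCorrelation {n m k : ℕ}
    (P : (Fin n → Fin m) → (Fin n → Fin k) → ℝ) : Prop :=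
  ∃ (d : Fin n → Type u) (M : ∀ i, Fin m → POVM k (d i))
    (Λ : Type v) (_ : MeasurableSpace Λ) (μ : MeasureTheory.Measure Λ)
    (ψ : Λ → HilbSp (∀ i, d i)),
    MeasureTheory.IsProbabilityMeasure μ ∧
    MeasureTheory.AEStronglyMeasurable ψ μ ∧
    (∀ᵐ l ∂μ, ‖ψ l‖ = 1 ∧ IsBiseparablePure (ψ l)) ∧
    ∀ s r, ((P s r : ℝ) : ℂ) = ∫ l, inner ℂ (ψ l) (jointEffect M s r (ψ l)) ∂μ

/-! ## The Bell expression -/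

/-- `P([r₁ + ⋯ + rₙ]_k = r)` for the settings `s`. -/
noncomputable def sumProb {n m k : ℕ} (P : (Fin n → Fin m) → (Fin n → Fin k) → ℝ)
    (s : Fin n → Fin m) (r : ℕ) : ℝ :=
  ∑ o : Fin n → Fin k with (∑ i, (o i : ℕ)) % k = r, P s o

/-- The Bell expression `Ω(n,m,k)`. -/
noncomputable def bellOmega (n m k : ℕ) (P : (Fin n → Fin m) → (Fin n → Fin k) → ℝ) : ℝ :=
  (∑ s : Fin n → Fin m with (∑ i, (s i : ℕ)) % m = 0, ∑ r ∈ Finset.range k,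
    ((((r : ℤ) - (((∑ i, (s i : ℕ)) / m : ℕ) : ℤ)) % (k : ℤ) : ℤ) : ℝ) * sumProb P s r)
  + ∑ s : Fin n → Fin m with (∑ i, (s i : ℕ)) % m = 1, ∑ r ∈ Finset.range k,
    (((-(r : ℤ) + (((∑ i, (s i : ℕ)) / m : ℕ) : ℤ)) % (k : ℤ) : ℤ) : ℝ) * sumProb P s r

/-- `η_j csc(η_j π / 2m) |cos((2j+1)π / 2m)|` with `η_j = gcd(2j+1, m)`. -/
noncomputable def trigObjective (m j : ℕ) : ℝ :=
  (Nat.gcd (2 * j + 1) m : ℝ) * (Real.sin ((Nat.gcd (2 * j + 1) m : ℝ) * Real.pi / (2 * m)))⁻¹ *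
    |Real.cos ((2 * j + 1 : ℝ) * Real.pi / (2 * m))|

/-!
A pure state that is a product across two groups of parties has full correlators
`E(s) = E₁(s₁) E₂(s₂)`, where `s₁`, `s₂` are the settings of the groups and `E₁`, `E₂` are expectations
of products of commuting self-adjoint contractions, hence real numbers in `[-1, 1]`. In terms of the
correlators, `Ω = m ^ (n - 1) - (∑ s, c(|s|) E(s)) / 2`, where `c(t) = (-1) ^ ⌊t / m⌋` for
`t ≡ 0, 1 (mod m)` and `c(t) = 0` otherwise (`bellOmega_two_eq`).

As `n ≥ 3`, one of the groups, say the second, has two members. Freezing the settings of all parties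
but one of the first group and two of the second leaves a tripartite sum
`∑ c(a + t₁ + t₂ + t₃) e(t₁) ⟪x(t₂), y(t₃)⟫` with `e` real, `|e| ≤ 1`, and `x`, `y` in the unit ball of a
Hilbert space. The function `c` is antiperiodic, so it is a combination of the characters
`t ↦ ω_j ^ t`, where `ω_j = exp (iπ(2j+1)/m)`; Cauchy–Schwarz and Parseval bound the sum by `m` times
the largest `|1 + ω_j⁻¹| |∑ e(t) ω_j ^ t|` (`norm_sum_bellSign_mul_inner_le`). The first factor is
`2 |cos ((2j+1)π/2m)|`, and the second, a signed sum of points of the circle, is at most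
`η csc (ηπ/2m)` with `η = gcd (2j+1, m)` (`sum_abs_cos_mul_le`). Their product is twice
`trigObjective m j`, whose maximum is `cot (π/2m)` (`trigObjective_le`). There are `m ^ (n - 3)` choices of
frozen settings, and the bound is preserved under mixtures.
-/

open ComplexConjugate

/-! ### Trigonometric bounds -/

/-- Cleared of denominators, `k cot (k x) ≤ cot x`. -/
theorem nat_mul_cos_mul_sin_le (x : ℝ) (hx : 0 ≤ x) (k : ℕ) (hk : k * x ≤ Real.pi / 2) :
    k * Real.cos (k * x) * Real.sin x ≤ Real.sin (k * x) * Real.cos x := by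
  induction k with
  | zero => simp
  | succ k ih =>
    push_cast at hk ⊢
    have hkx : 0 ≤ k * x := by positivity
    rw [add_one_mul] at hk
    have ih' := ih (by linarith)
    have hpi := Real.pi_pos
    have hk0 : (0 : ℝ) ≤ k := by positivity
    by_cases hk' : k = 0
    · subst hk'; simp [mul_comm]
    have hk1 : (1 : ℝ) ≤ k := by exact_mod_cast Nat.one_le_iff_ne_zero.2 hk'
    have hx2 : x ≤ Real.pi / 2 := by nlinarith
    have s1 : 0 ≤ Real.sin x := Real.sin_nonneg_of_nonneg_of_le_pi hx (by linarith)
    have s2 : 0 ≤ Real.sin (k * x) := Real.sin_nonneg_of_nonneg_of_le_pi hkx (by linarith)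
    have c1 : 0 ≤ Real.cos x := Real.cos_nonneg_of_neg_pi_div_two_le_of_le (by linarith) hx2
    rw [add_one_mul (k : ℝ) x, Real.sin_add, Real.cos_add]
    have h1 := mul_le_mul_of_nonneg_right ih' c1
    have h2 : 0 ≤ (k + 1) * (Real.sin (k * x) * Real.sin x * Real.sin x) := by positivity
    nlinarith

theorem nat_mul_cot_le_cot {x : ℝ} (hx : 0 < x) {k : ℕ} (hk0 : 0 < k)
    (hk : k * x ≤ Real.pi / 2) : k * Real.cot (k * x) ≤ Real.cot x := by
  have hpi := Real.pi_pos
  have hk1 : (1 : ℝ) ≤ k := by exact_mod_cast hk0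
  have hx2 : x ≤ Real.pi / 2 := by nlinarith
  have s1 : 0 < Real.sin x := Real.sin_pos_of_pos_of_lt_pi hx (by linarith)
  have s2 : 0 < Real.sin (k * x) := Real.sin_pos_of_pos_of_lt_pi (by positivity) (by linarith)
  rw [Real.cot_eq_cos_div_sin, Real.cot_eq_cos_div_sin, ← mul_div_assoc, div_le_div_iff₀ s2 s1]
  linarith [nat_mul_cos_mul_sin_le x hx.le k hk]

/-- An odd multiple of `π / 2M` is at distance at least `π / 2M` from `π ℤ`. -/
theorem abs_cos_odd_mul_le {M q : ℕ} (hM : 0 < M) (hq : Odd q) :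
    |Real.cos (q * Real.pi / (2 * M))| ≤ Real.cos (Real.pi / (2 * M)) := by
  have hM' : (1 : ℝ) ≤ M := by exact_mod_cast hM
  have hpi := Real.pi_pos
  -- write `q = r + 2 M k` with `|r| ≤ M`; since `q` is odd, `|r| ≥ 1`
  obtain ⟨r, k, hr, hr1, hrM⟩ : ∃ r k : ℤ, (q : ℤ) = r + 2 * M * k ∧ 1 ≤ |r| ∧ |r| ≤ M := by
    refine ⟨Int.bmod q (2 * M), ((q : ℤ) - Int.bmod q (2 * M)) / (2 * M), ?_, ?_, ?_⟩
    · have : (2 * M : ℤ) ∣ (q : ℤ) - Int.bmod q (2 * M) := by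
        have := Int.dvd_self_sub_bmod (x := (q : ℤ)) (m := 2 * M)
        exact_mod_cast this
      rw [Int.mul_ediv_cancel' this]; ring
    · apply Int.one_le_abs
      intro h0
      have := Int.dvd_of_bmod_eq_zero h0
      obtain ⟨j, hj⟩ := hq
      obtain ⟨c, hc⟩ := this
      push_cast at hc
      have : (2 : ℤ) ∣ 1 := ⟨M * c - j, by subst hj; push_cast at hc; linarith⟩
      norm_num at this
    · have h1 := Int.le_bmod (x := (q : ℤ)) (m := 2 * M) (by omega)
      have h2 := Int.bmod_lt (x := (q : ℤ)) (m := 2 * M) (by omega)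
      rw [abs_le]; push_cast at h1 h2; constructor <;> omega
  have e : (q : ℝ) * Real.pi / (2 * M) = r * Real.pi / (2 * M) + k * Real.pi := by
    have : (q : ℝ) = r + 2 * M * k := by exact_mod_cast hr
    rw [this]; field_simp
  rw [e, Real.cos_add_int_mul_pi, abs_mul, abs_zpow, abs_neg, abs_one, one_zpow, one_mul]
  have hr1' : (1 : ℝ) ≤ |(r : ℝ)| := by exact_mod_cast hr1
  have hrM' : |(r : ℝ)| ≤ M := by exact_mod_cast hrM
  have e2 : Real.cos (r * Real.pi / (2 * M)) = Real.cos (|(r : ℝ)| * Real.pi / (2 * M)) := by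
    rw [← Real.cos_abs, abs_div, abs_mul, abs_of_pos hpi, abs_of_pos (by positivity : 0 < 2 * (M:ℝ))]
  have b : |(r : ℝ)| * Real.pi / (2 * M) ≤ Real.pi / 2 := by
    rw [div_le_div_iff₀ (by positivity) (by positivity)]; nlinarith
  rw [e2, abs_of_nonneg (Real.cos_nonneg_of_neg_pi_div_two_le_of_le
    (by have : 0 ≤ |(r : ℝ)| * Real.pi / (2 * M) := by positivity
        linarith) b)]
  apply Real.cos_le_cos_of_nonneg_of_le_pi (by positivity) (by linarith)
  gcongr
  nlinarith

theorem two_mul_sin_mul_sum_cos (φ δ : ℝ) (M : ℕ) :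
    2 * Real.sin (δ / 2) * ∑ t ∈ Finset.range M, Real.cos (φ + t * δ) =
      Real.sin (φ + M * δ - δ / 2) - Real.sin (φ - δ / 2) := by
  induction M with
  | zero => simp
  | succ M ih =>
    rw [Finset.sum_range_succ, mul_add, ih]
    push_cast
    have h1 : φ + (M + 1) * δ - δ / 2 = φ + M * δ + δ / 2 := by ring
    rw [h1, Real.sin_add (φ + M * δ), Real.sin_sub (φ + M * δ)]
    ring

theorem abs_cos_add_int_mul_pi (x : ℝ) (k : ℤ) : |Real.cos (x + k * Real.pi)| = |Real.cos x| := by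
  rw [Real.cos_add_int_mul_pi, abs_mul, abs_zpow, abs_neg, abs_one, one_zpow, one_mul]

/-- For a function `h` on `ℤ` of period `M`, the sum over a full period does not depend on the
starting point, and is invariant under multiplication of the argument by a unit modulo `M`. -/
theorem sum_range_periodic_affine {M : ℕ} (hM : 0 < M) {h : ℤ → ℝ} (hp : ∀ t k, h (t + k * M) = h t)
    {q : ℕ} (hq : Nat.Coprime q M) (a : ℤ) :
    ∑ t ∈ Finset.range M, h (q * t + a) = ∑ t ∈ Finset.range M, h t := by
  have hmod : ∀ t : ℤ, h (t % M) = h t := fun t => by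
    conv_rhs => rw [← Int.emod_add_mul_ediv t M, mul_comm]
    exact (hp _ _).symm
  have hM0 : (M : ℤ) ≠ 0 := by exact_mod_cast hM.ne'
  have hMp : (0 : ℤ) < M := by exact_mod_cast hM
  have hlt : ∀ t : ℕ, ((q * t + a : ℤ) % M).toNat < M := fun t => by
    have := Int.emod_lt_of_pos (q * t + a : ℤ) hMp; omega
  have hmaps : Set.MapsTo (fun t : ℕ => ((q * t + a : ℤ) % M).toNat) (Finset.range M)
      (Finset.range M) := fun t _ => Finset.mem_coe.2 (Finset.mem_range.2 (hlt t))
  have hinj : Set.InjOn (fun t : ℕ => ((q * t + a : ℤ) % M).toNat) (Finset.range M) := by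
    intro t ht t' ht' h
    have ht := Finset.mem_range.1 (Finset.mem_coe.1 ht)
    have ht' := Finset.mem_range.1 (Finset.mem_coe.1 ht')
    have h1 : (q * t + a : ℤ) % M = (q * t' + a : ℤ) % M := by
      have := Int.emod_nonneg (q * t + a : ℤ) hM0
      have := Int.emod_nonneg (q * t' + a : ℤ) hM0
      simp only at h; omega
    have h2 : ((q * t : ℕ) : ℤ) ≡ ((q * t' : ℕ) : ℤ) [ZMOD M] := by
      push_cast; exact Int.ModEq.add_right_cancel' a h1
    have h3 := Nat.ModEq.cancel_left_of_coprime (hq.symm) (Int.natCast_modEq_iff.1 h2)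
    rwa [Nat.ModEq, Nat.mod_eq_of_lt ht, Nat.mod_eq_of_lt ht'] at h3
  refine Finset.sum_nbij (fun t => ((q * t + a : ℤ) % M).toNat) hmaps hinj
    (Finset.surjOn_of_injOn_of_card_le _ hmaps hinj le_rfl) ?_
  · intro t _
    rw [Int.toNat_of_nonneg (Int.emod_nonneg _ hM0), hmod]

/-- Projected to a line, `M` consecutive vertices of the regular `2M`-gon have distances from the
centre adding up to at most `csc (π / 2M)`: after reduction modulo `π`, all the cosines can be taken nonnegative, and the sum
telescopes. -/
theorem sum_abs_cos_le {M : ℕ} (hM : 0 < M) (θ : ℝ) :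
    ∑ t ∈ Finset.range M, |Real.cos (t * Real.pi / M + θ)| ≤ (Real.sin (Real.pi / (2 * M)))⁻¹ := by
  have hpi := Real.pi_pos
  have hM' : (1 : ℝ) ≤ M := by exact_mod_cast hM
  set δ := Real.pi / M with hδ
  have hδ0 : 0 < δ := by positivity
  have hMδ : M * δ = Real.pi := by rw [hδ]; field_simp
  have hδ2 : Real.pi / (2 * M) = δ / 2 := by rw [hδ]; field_simp
  have hsin : 0 < Real.sin (δ / 2) := Real.sin_pos_of_pos_of_lt_pi (by positivity) (by nlinarith)
  -- shift the progression so that it starts in `[-π/2, -π/2 + δ)`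
  obtain ⟨a, φ, hφ, hφ1, hφ2⟩ : ∃ (a : ℤ) (φ : ℝ), θ + a * δ = φ ∧ -(Real.pi / 2) ≤ φ ∧
      φ < -(Real.pi / 2) + δ := by
    refine ⟨-⌊(θ + Real.pi / 2) / δ⌋, _, rfl, ?_, ?_⟩
    · have := Int.floor_le ((θ + Real.pi / 2) / δ)
      rw [le_div_iff₀ hδ0] at this
      push_cast; linarith
    · have := Int.lt_floor_add_one ((θ + Real.pi / 2) / δ)
      rw [div_lt_iff₀ hδ0] at this
      push_cast; linarith
  have key := sum_range_periodic_affine hM (h := fun t => |Real.cos (θ + t * δ)|)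
    (fun t k => by
      have : θ + ((t + k * M : ℤ) : ℝ) * δ = θ + t * δ + k * Real.pi := by
        push_cast; rw [← hMδ]; ring
      simp only [this, abs_cos_add_int_mul_pi]) (q := 1) (by simp) a
  have e1 : ∑ t ∈ Finset.range M, |Real.cos (t * Real.pi / M + θ)|
      = ∑ t ∈ Finset.range M, Real.cos (φ + t * δ) := by
    trans ∑ t ∈ Finset.range M, |Real.cos (θ + ((t : ℤ) : ℝ) * δ)|
    · refine Finset.sum_congr rfl fun t _ => ?_
      congr 2; rw [hδ]; push_cast; ring
    rw [← key]
    refine Finset.sum_congr rfl fun t ht => ?_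
    have ht' : (t : ℝ) + 1 ≤ M := by exact_mod_cast Finset.mem_range.1 ht
    have : θ + (((1 : ℕ) * (t : ℤ) + a : ℤ) : ℝ) * δ = φ + t * δ := by
      rw [← hφ]; push_cast; ring
    rw [this, abs_of_nonneg]
    have h0 : (0 : ℝ) ≤ t * δ := by positivity
    refine Real.cos_nonneg_of_neg_pi_div_two_le_of_le (by linarith) ?_
    nlinarith
  rw [e1, hδ2, ← one_div, le_div_iff₀ hsin]
  have := two_mul_sin_mul_sum_cos φ δ M
  rw [hMδ] at this
  have h3 : φ + Real.pi - δ / 2 = φ - δ / 2 + Real.pi := by ring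
  rw [h3, Real.sin_add_pi] at this
  have := Real.neg_one_le_sin (φ - δ / 2)
  linarith

/-- With `η = gcd (p, m)`, the lines through the points `exp (iπps/m)` are the `m / η` diagonals of a
regular polygon, each covered `η` times. -/
theorem sum_abs_cos_mul_le {m p : ℕ} (hm : 0 < m) (θ : ℝ) :
    ∑ s ∈ Finset.range m, |Real.cos (p * s * Real.pi / m + θ)| ≤
      Nat.gcd p m * (Real.sin (Nat.gcd p m * Real.pi / (2 * m)))⁻¹ := by
  obtain ⟨q, M, hco, hp, hmM⟩ := Nat.exists_coprime p m
  set η := Nat.gcd p m with hη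
  have hη0 : 0 < η := Nat.gcd_pos_of_pos_right _ hm
  have hM : 0 < M := Nat.pos_of_mul_pos_right (hmM ▸ hm)
  have hηr : (0 : ℝ) < η := by exact_mod_cast hη0
  have hMr : (0 : ℝ) < M := by exact_mod_cast hM
  have hmr : (m : ℝ) = M * η := by exact_mod_cast hmM
  have hpr : (p : ℝ) = q * η := by exact_mod_cast hp
  have hper : ∀ t k : ℤ, |Real.cos (((t + k * M : ℤ) : ℝ) * Real.pi / M + θ)|
      = |Real.cos ((t : ℝ) * Real.pi / M + θ)| := fun t k => by
    have : ((t + k * M : ℤ) : ℝ) * Real.pi / M + θ = t * Real.pi / M + θ + k * Real.pi := by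
      push_cast; field_simp; ring
    rw [this, abs_cos_add_int_mul_pi]
  have e : ∀ s : ℕ, (p : ℝ) * s * Real.pi / m + θ = ((q * s : ℤ) : ℝ) * Real.pi / M + θ := by
    intro s; rw [hmr, hpr]; push_cast; field_simp
  have e3 : (η : ℝ) * Real.pi / (2 * m) = Real.pi / (2 * M) := by rw [hmr]; field_simp
  rw [e3]
  simp only [e]
  have hblock : ∀ k : ℕ, ∑ s ∈ Finset.range (k * M), |Real.cos (((q * s : ℤ) : ℝ) * Real.pi / M + θ)|
      = k * ∑ t ∈ Finset.range M, |Real.cos (((t : ℤ) : ℝ) * Real.pi / M + θ)| := by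
    intro k
    induction k with
    | zero => simp
    | succ k ih =>
      rw [add_one_mul, Finset.sum_range_add, ih]
      push_cast
      rw [add_one_mul]
      congr 1
      have := sum_range_periodic_affine hM
        (h := fun t => |Real.cos ((t : ℝ) * Real.pi / M + θ)|) hper hco (q * (k * M))
      push_cast at this
      rw [← this]
      refine Finset.sum_congr rfl fun t _ => ?_
      congr 4; ring
  have hmM' : m = η * M := by rw [hmM, mul_comm]
  rw [hmM', hblock]
  gcongr
  simpa using sum_abs_cos_le hM θ

theorem trigObjective_zero {m : ℕ} (hm : 2 ≤ m) :
    trigObjective m 0 = Real.cot (Real.pi / (2 * m)) := by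
  have hpi := Real.pi_pos
  have hm' : (2 : ℝ) ≤ m := by exact_mod_cast hm
  have h : Real.pi / (2 * m) ≤ Real.pi / 2 := by gcongr; linarith
  have h0 : 0 ≤ Real.pi / (2 * m) := by positivity
  simp only [trigObjective, mul_zero, zero_add, Nat.gcd_one_left, Nat.cast_one, Nat.cast_zero,
    one_mul]
  rw [abs_of_nonneg (Real.cos_nonneg_of_neg_pi_div_two_le_of_le (by linarith) h),
    Real.cot_eq_cos_div_sin, div_eq_inv_mul (Real.cos _)]

/-- With `η = gcd (2j + 1, m)` and `M = m / η`, the odd multiple in the cosine contributes at most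
`cos (π / 2M)`, which leaves `η cot (η x) ≤ cot x` for `x = π / 2m`. -/
theorem trigObjective_le {m : ℕ} (hm : 2 ≤ m) (j : ℕ) :
    trigObjective m j ≤ Real.cot (Real.pi / (2 * m)) := by
  have hpi := Real.pi_pos
  have hm0 : 0 < m := by omega
  obtain ⟨q, M, hco, hp, hmM⟩ := Nat.exists_coprime (2 * j + 1) m
  rw [trigObjective]
  set η := Nat.gcd (2 * j + 1) m with hη
  have hη0 : 0 < η := Nat.gcd_pos_of_pos_right _ hm0
  have hM : 0 < M := Nat.pos_of_mul_pos_right (hmM ▸ hm0)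
  have hηr : (0 : ℝ) < η := by exact_mod_cast hη0
  have hMr : (1 : ℝ) ≤ M := by exact_mod_cast hM
  have hmr : (m : ℝ) = M * η := by exact_mod_cast hmM
  have hpr : (2 * j + 1 : ℝ) = q * η := by exact_mod_cast hp
  have hq : Odd q := by
    have : Odd (q * η) := hp ▸ odd_two_mul_add_one j
    exact (Nat.odd_mul.1 this).1
  have e3 : (η : ℝ) * Real.pi / (2 * m) = Real.pi / (2 * M) := by rw [hmr]; field_simp
  have e4 : (2 * j + 1 : ℝ) * Real.pi / (2 * m) = q * Real.pi / (2 * M) := by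
    rw [hpr, hmr]; field_simp
  have e5 : Real.pi / (2 * M) = η * (Real.pi / (2 * m)) := by rw [hmr]; field_simp
  have hle : Real.pi / (2 * M) ≤ Real.pi / 2 := by gcongr; linarith
  have hs : 0 < Real.sin (Real.pi / (2 * M)) :=
    Real.sin_pos_of_pos_of_lt_pi (by positivity) (by linarith)
  rw [e3, e4]
  have hc := nat_mul_cot_le_cot (x := Real.pi / (2 * m)) (by positivity) hη0 (e5 ▸ hle)
  rw [← e5] at hc
  refine le_trans ?_ hc
  rw [Real.cot_eq_cos_div_sin, div_eq_inv_mul (Real.cos _), ← mul_assoc]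
  gcongr
  exact abs_cos_odd_mul_le hM hq

/-! ### Antiperiodic Fourier analysis -/

/-- The `m`-th roots of `-1`, i.e. the characters `t ↦ ω ^ t` of `ℤ` with `ω ^ (t + m) = -ω ^ t`. -/
noncomputable def negOneRoot (m j : ℕ) : ℂ :=
  Complex.exp (((2 * j + 1 : ℝ) * Real.pi / m : ℝ) * Complex.I)

theorem negOneRoot_ne_zero (m j : ℕ) : negOneRoot m j ≠ 0 := Complex.exp_ne_zero _

theorem norm_negOneRoot (m j : ℕ) : ‖negOneRoot m j‖ = 1 := Complex.norm_exp_ofReal_mul_I _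

theorem negOneRoot_pow (m j t : ℕ) : negOneRoot m j ^ t =
    Complex.exp ((((2 * j + 1 : ℕ) : ℝ) * t * Real.pi / m : ℝ) * Complex.I) := by
  rw [negOneRoot, ← Complex.exp_nat_mul]
  congr 1; push_cast; ring

theorem negOneRoot_zpow_mul {m : ℕ} (hm : m ≠ 0) (j : ℕ) (k : ℤ) :
    negOneRoot m j ^ (m * k : ℤ) = (-1) ^ k := by
  have hm' : (m : ℝ) ≠ 0 := by exact_mod_cast hm
  rw [zpow_mul, zpow_natCast, negOneRoot_pow]
  congr 1
  have : ((2 * j + 1 : ℕ) : ℝ) * m * Real.pi / m = Real.pi + j * (2 * Real.pi) := by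
    push_cast; field_simp
    ring
  rw [this]
  push_cast
  rw [add_mul, Complex.exp_add, Complex.exp_pi_mul_I]
  have := Complex.exp_nat_mul_two_pi_mul_I j
  rw [show (j : ℂ) * (2 * Real.pi) * Complex.I = j * (2 * Real.pi * Complex.I) by ring, this, mul_one]

theorem sum_negOneRoot_zpow_of_not_dvd {m : ℕ} (hm : m ≠ 0) {t : ℤ} (ht : ¬ (m : ℤ) ∣ t) :
    ∑ j ∈ Finset.range m, negOneRoot m j ^ t = 0 := by
  have hζ := Complex.isPrimitiveRoot_exp m hm
  set ζ := Complex.exp (2 * Real.pi * Complex.I / m) with hζd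
  have hm' : (m : ℂ) ≠ 0 := by exact_mod_cast hm
  have e : ∀ j : ℕ, negOneRoot m j ^ t = negOneRoot m 0 ^ t * (ζ ^ t) ^ j := by
    intro j
    have : negOneRoot m j = negOneRoot m 0 * ζ ^ j := by
      rw [negOneRoot, negOneRoot, hζd, ← Complex.exp_nat_mul, ← Complex.exp_add]
      congr 1; push_cast; field_simp
      ring
    rw [this, mul_zpow]
    congr 1
    rw [← zpow_natCast, ← zpow_natCast, ← zpow_mul, ← zpow_mul, mul_comm]
  have h1 : ζ ^ t ≠ 1 := fun h => ht ((hζ.zpow_eq_one_iff_dvd t).1 h)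
  have h2 : (ζ ^ t) ^ m = 1 := by
    rw [← zpow_natCast, ← zpow_mul, mul_comm, zpow_mul, zpow_natCast, hζ.pow_eq_one, one_zpow]
  rw [Finset.sum_congr rfl fun j _ => e j, ← Finset.mul_sum, geom_sum_eq h1, h2, sub_self, zero_div, mul_zero]

/-- The sign `(-1) ^ ⌊t / m⌋` with which the correlators at settings of sum `t ≡ 0, 1 (mod m)` enter
the Bell expression; it is `0` for all other `t`. -/
noncomputable def bellSign (m t : ℕ) : ℝ := if t % m = 0 ∨ t % m = 1 then (-1) ^ (t / m) else 0

theorem natCast_mul_bellSign {m : ℕ} (hm : 2 ≤ m) (t : ℕ) :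
    (m : ℂ) * bellSign m t =
      ∑ j ∈ Finset.range m, (1 + (negOneRoot m j)⁻¹) * negOneRoot m j ^ t := by
  have hm0 : m ≠ 0 := by omega
  have e : ∀ j, (1 + (negOneRoot m j)⁻¹) * negOneRoot m j ^ t
      = negOneRoot m j ^ (t : ℤ) + negOneRoot m j ^ (t - 1 : ℤ) := fun j => by
    rw [zpow_sub_one₀ (negOneRoot_ne_zero m j), zpow_natCast]; ring
  simp only [e, Finset.sum_add_distrib]
  have hs : ∀ (k : ℕ), ∑ j ∈ Finset.range m, negOneRoot m j ^ (m * k : ℤ) = m * (-1) ^ k :=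
    fun k => by
      rw [Finset.sum_congr rfl fun j _ => negOneRoot_zpow_mul hm0 j k]
      simp
  have hdm := Nat.div_add_mod t m
  have hdm' : (t : ℤ) = m * (t / m : ℕ) + (t % m : ℕ) := by exact_mod_cast hdm.symm
  have hnd : ∀ (z : ℤ), 0 < z → z < m → ∀ k : ℤ, ¬ (m : ℤ) ∣ m * k + z := fun z h0 h1 k h => by
    have := (Int.dvd_add_right (dvd_mul_right _ _)).1 h
    have := Int.le_of_dvd h0 this
    omega
  have hlt := Nat.mod_lt t (show 0 < m by omega)
  rw [bellSign]
  by_cases h0 : t % m = 0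
  · have e1 : (t : ℤ) = m * (t / m : ℕ) := by rw [hdm', h0]; simp
    have e2 : (t - 1 : ℤ) = m * ((t / m : ℕ) - 1) + (m - 1) := by rw [e1]; ring
    rw [if_pos (Or.inl h0), sum_negOneRoot_zpow_of_not_dvd hm0 (t := t - 1)
      (e2 ▸ hnd _ (by omega) (by omega) _), e1, hs]
    simp
  by_cases h1 : t % m = 1
  · have e1 : (t - 1 : ℤ) = m * (t / m : ℕ) := by rw [hdm', h1]; simp
    rw [if_pos (Or.inr h1), sum_negOneRoot_zpow_of_not_dvd hm0 (t := t)
      (hdm' ▸ hnd _ (by omega) (by omega) _), e1, hs]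
    simp
  · have e2 : (t - 1 : ℤ) = m * (t / m : ℕ) + ((t % m : ℕ) - 1) := by
      conv_lhs => rw [hdm']
      ring
    rw [if_neg (by tauto), sum_negOneRoot_zpow_of_not_dvd hm0 (t := t)
      (hdm' ▸ hnd _ (by omega) (by omega) _), sum_negOneRoot_zpow_of_not_dvd hm0 (t := t - 1)
      (e2 ▸ hnd _ (by omega) (by omega) _)]
    simp

theorem norm_one_add_inv_negOneRoot (m j : ℕ) :
    ‖1 + (negOneRoot m j)⁻¹‖ = 2 * |Real.cos ((2 * j + 1 : ℝ) * Real.pi / (2 * m))| := by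
  set x := (2 * j + 1 : ℝ) * Real.pi / (2 * m) with hx
  have e : 1 + (negOneRoot m j)⁻¹ =
      Complex.exp ((-x : ℝ) * Complex.I) * ((2 * Real.cos x : ℝ) : ℂ) := by
    have : (2 * j + 1 : ℝ) * Real.pi / m = 2 * x := by rw [hx]; ring
    rw [negOneRoot, this, ← Complex.exp_neg]
    push_cast
    rw [Complex.two_cos, mul_add, ← Complex.exp_add, ← Complex.exp_add]
    congr 1
    · rw [← Complex.exp_zero]; congr 1; ring
    · congr 1; ring
  rw [e, norm_mul, Complex.norm_exp_ofReal_mul_I, one_mul, Complex.norm_real, Real.norm_eq_abs,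
    abs_mul, abs_two]

theorem norm_sum_mul_negOneRoot_pow_le {m : ℕ} (hm : 0 < m) (j : ℕ) (e : Fin m → ℝ)
    (he : ∀ t, |e t| ≤ 1) :
    ‖∑ t : Fin m, (e t : ℂ) * negOneRoot m j ^ (t : ℕ)‖ ≤
      Nat.gcd (2 * j + 1) m * (Real.sin (Nat.gcd (2 * j + 1) m * Real.pi / (2 * m)))⁻¹ := by
  set z := ∑ t : Fin m, (e t : ℂ) * negOneRoot m j ^ (t : ℕ) with hz
  -- rotate `z` to the positive real axis
  have h1 : ‖z‖ = (z * Complex.exp ((-z.arg : ℝ) * Complex.I)).re := by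
    conv_rhs => rw [← Complex.norm_mul_exp_arg_mul_I z, mul_assoc, ← Complex.exp_add]
    simp
  rw [h1, hz, Finset.sum_mul, Complex.re_sum]
  refine le_trans ?_ (sum_abs_cos_mul_le hm (-z.arg))
  rw [Finset.sum_range (fun s => |Real.cos (((2 * j + 1 : ℕ) : ℝ) * s * Real.pi / m + -z.arg)|)]
  refine Finset.sum_le_sum fun t _ => ?_
  rw [negOneRoot_pow, mul_assoc, ← Complex.exp_add, ← add_mul, ← Complex.ofReal_add,
    Complex.re_ofReal_mul, Complex.exp_ofReal_mul_I_re]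
  refine (le_abs_self _).trans ?_
  rw [abs_mul]
  exact mul_le_of_le_one_left (abs_nonneg _) (he t)

/-- The Fourier coefficients of the convolution of the Bell coefficients with a sign function. -/
theorem norm_fourierCoeff_mul_le {m : ℕ} (hm : 2 ≤ m) (j : ℕ) (e : Fin m → ℝ)
    (he : ∀ t, |e t| ≤ 1) :
    ‖(1 + (negOneRoot m j)⁻¹) * ∑ t : Fin m, (e t : ℂ) * negOneRoot m j ^ (t : ℕ)‖ ≤
      2 * Real.cot (Real.pi / (2 * m)) := by
  rw [norm_mul, norm_one_add_inv_negOneRoot]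
  have h := norm_sum_mul_negOneRoot_pow_le (by omega) j e he
  have h2 := trigObjective_le hm j
  rw [trigObjective] at h2
  have := mul_le_mul_of_nonneg_left h
    (abs_nonneg (Real.cos ((2 * j + 1 : ℝ) * Real.pi / (2 * m))))
  linarith

section FourierBound

variable {H : Type*} [NormedAddCommGroup H] [InnerProductSpace ℂ H]

theorem sum_norm_sq_of_orthogonal {m : ℕ} (w : ℕ → Fin m → ℂ)
    (hw : ∀ s t, ∑ j ∈ Finset.range m, conj (w j s) * w j t = if s = t then (m : ℂ) else 0)
    (x : Fin m → H) :
    ∑ j ∈ Finset.range m, ‖∑ t, w j t • x t‖ ^ 2 = m * ∑ t, ‖x t‖ ^ 2 := by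
  have : ((∑ j ∈ Finset.range m, ‖∑ t, w j t • x t‖ ^ 2 : ℝ) : ℂ)
      = ((m * ∑ t, ‖x t‖ ^ 2 : ℝ) : ℂ) := by
    push_cast
    have e : ∀ v : H, ((‖v‖ : ℂ)) ^ 2 = inner ℂ v v := fun v => (inner_self_eq_norm_sq_to_K v).symm
    simp only [e]
    have e2 : ∀ j, inner ℂ (∑ t, w j t • x t) (∑ t, w j t • x t)
        = ∑ s, ∑ t, conj (w j s) * (w j t * inner ℂ (x s) (x t)) := fun j => by
      rw [sum_inner]
      simp only [inner_sum, inner_smul_left, inner_smul_right]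
      exact Finset.sum_congr rfl fun s _ => Finset.sum_congr rfl fun t _ => mul_left_comm _ _ _
    rw [Finset.sum_congr rfl fun j _ => e2 j, Finset.sum_comm, Finset.mul_sum]
    refine Finset.sum_congr rfl fun s _ => ?_
    rw [Finset.sum_comm]
    have : ∀ t, ∑ j ∈ Finset.range m, conj (w j s) * (w j t * inner ℂ (x s) (x t))
        = (if s = t then (m : ℂ) else 0) * inner ℂ (x s) (x t) := fun t => by
      rw [← hw, Finset.sum_mul]; simp only [mul_assoc]
    rw [Finset.sum_congr rfl fun t _ => this t]
    simp
  exact_mod_cast this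

theorem negOneRoot_orthogonal {m : ℕ} (hm : m ≠ 0) (s t : Fin m) :
    ∑ j ∈ Finset.range m, conj (negOneRoot m j ^ (s : ℕ)) * negOneRoot m j ^ (t : ℕ) =
      if s = t then (m : ℂ) else 0 := by
  have e : ∀ j, conj (negOneRoot m j ^ (s : ℕ)) * negOneRoot m j ^ (t : ℕ)
      = negOneRoot m j ^ ((t : ℤ) - (s : ℤ)) := fun j => by
    rw [← Complex.inv_eq_conj (by rw [norm_pow, norm_negOneRoot, one_pow]),
      zpow_sub₀ (negOneRoot_ne_zero m j), zpow_natCast, zpow_natCast, div_eq_inv_mul]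
  simp only [e]
  split_ifs with h
  · subst h; simp
  · refine sum_negOneRoot_zpow_of_not_dvd hm fun hd => h ?_
    have := Int.eq_zero_of_abs_lt_dvd hd (by rw [abs_lt]; omega)
    ext; omega

/-- A tripartite bound in which the first party answers deterministically (or by real averages)
and the other two by quantum correlations: the coefficients are diagonalised by the antiperiodic
Fourier transform, and Cauchy–Schwarz and Parseval reduce the bound to the largest Fourier
coefficient. -/
theorem norm_sum_bellSign_mul_inner_le {m : ℕ} (hm : 2 ≤ m) (a : ℕ) (e : Fin m → ℝ)
    (he : ∀ t, |e t| ≤ 1) (x y : Fin m → H) (hx : ∀ t, ‖x t‖ ≤ 1) (hy : ∀ t, ‖y t‖ ≤ 1) :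
    ‖∑ t₁ : Fin m, ∑ t₂ : Fin m, ∑ t₃ : Fin m, (bellSign m (a + t₁ + t₂ + t₃) : ℂ) * (e t₁ * inner ℂ (x t₂) (y t₃))‖ ≤
      2 * m * Real.cot (Real.pi / (2 * m)) := by
  have hm0 : m ≠ 0 := by omega
  have hmr : (0 : ℝ) < m := by exact_mod_cast (by omega : 0 < m)
  set S := ∑ t₁ : Fin m, ∑ t₂ : Fin m, ∑ t₃ : Fin m, (bellSign m (a + t₁ + t₂ + t₃) : ℂ) *
    (e t₁ * inner ℂ (x t₂) (y t₃)) with hS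
  set E : ℕ → ℂ := fun j =>
    (1 + (negOneRoot m j)⁻¹) * ∑ t : Fin m, (e t : ℂ) * negOneRoot m j ^ (t : ℕ) with hE
  set X : ℕ → H := fun j => ∑ t : Fin m, conj (negOneRoot m j ^ (t : ℕ)) • x t with hX
  set Y : ℕ → H := fun j => ∑ t : Fin m, (negOneRoot m j ^ (t : ℕ)) • y t with hY
  have key : (m : ℂ) * S =
      ∑ j ∈ Finset.range m, negOneRoot m j ^ a * (E j * inner ℂ (X j) (Y j)) := by
    have hterm : ∀ j, negOneRoot m j ^ a * (E j * inner ℂ (X j) (Y j)) =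
        ∑ t₁ : Fin m, ∑ t₂ : Fin m, ∑ t₃ : Fin m, ((1 + (negOneRoot m j)⁻¹) *
          negOneRoot m j ^ (a + t₁ + t₂ + t₃ : ℕ)) * (e t₁ * inner ℂ (x t₂) (y t₃)) := fun j => by
      have h1 : inner ℂ (X j) (Y j) = ∑ t₂ : Fin m, ∑ t₃ : Fin m,
          negOneRoot m j ^ (t₂ : ℕ) * (negOneRoot m j ^ (t₃ : ℕ) * inner ℂ (x t₂) (y t₃)) := by
        simp only [hX, hY]
        rw [sum_inner]
        simp only [inner_sum, inner_smul_left, inner_smul_right, Complex.conj_conj]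
        exact Finset.sum_congr rfl fun s _ => Finset.sum_congr rfl fun t _ => mul_left_comm _ _ _
      have h2 : ∀ t₁ t₂ t₃ : Fin m, ((1 + (negOneRoot m j)⁻¹) *
          negOneRoot m j ^ (a + t₁ + t₂ + t₃ : ℕ)) * (e t₁ * inner ℂ (x t₂) (y t₃)) =
          (negOneRoot m j ^ a * (1 + (negOneRoot m j)⁻¹) * (e t₁ * negOneRoot m j ^ (t₁ : ℕ))) *
          (negOneRoot m j ^ (t₂ : ℕ) * (negOneRoot m j ^ (t₃ : ℕ) * inner ℂ (x t₂) (y t₃))) := by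
        intro t₁ t₂ t₃; ring
      simp only [h1, h2, hE, ← Finset.mul_sum, ← Finset.sum_mul]
      ring
    rw [Finset.sum_congr rfl fun j _ => hterm j, Finset.sum_comm, hS, Finset.mul_sum]
    refine Finset.sum_congr rfl fun t₁ _ => ?_
    rw [Finset.sum_comm (s := Finset.range m), Finset.mul_sum]
    refine Finset.sum_congr rfl fun t₂ _ => ?_
    rw [Finset.sum_comm (s := Finset.range m), Finset.mul_sum]
    refine Finset.sum_congr rfl fun t₃ _ => ?_
    rw [← mul_assoc, natCast_mul_bellSign hm, Finset.sum_mul]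
  have hXs : ∑ j ∈ Finset.range m, ‖X j‖ ^ 2 ≤ m * m := by
    rw [hX, sum_norm_sq_of_orthogonal _ _ x]
    · gcongr
      calc ∑ t, ‖x t‖ ^ 2 ≤ ∑ t : Fin m, (1 : ℝ) :=
            Finset.sum_le_sum fun t _ => pow_le_one₀ (norm_nonneg _) (hx t)
        _ = m := by simp
    · intro s t
      have := negOneRoot_orthogonal hm0 t s
      simp only [Complex.conj_conj]
      simp only [eq_comm (a := t)] at this
      rw [← this]
      exact Finset.sum_congr rfl fun j _ => mul_comm _ _
  have hYs : ∑ j ∈ Finset.range m, ‖Y j‖ ^ 2 ≤ m * m := by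
    rw [hY, sum_norm_sq_of_orthogonal _ (negOneRoot_orthogonal hm0) y]
    gcongr
    calc ∑ t, ‖y t‖ ^ 2 ≤ ∑ t : Fin m, (1 : ℝ) :=
          Finset.sum_le_sum fun t _ => pow_le_one₀ (norm_nonneg _) (hy t)
      _ = m := by simp
  have hE' : ∀ j, ‖E j‖ ≤ 2 * Real.cot (Real.pi / (2 * m)) := fun j =>
    norm_fourierCoeff_mul_le hm j e he
  have hcot : 0 ≤ Real.cot (Real.pi / (2 * m)) := by
    have := (norm_nonneg _).trans (hE' 0); linarith
  have hb : (m : ℝ) * ‖S‖ ≤ 2 * Real.cot (Real.pi / (2 * m)) * (m * m) := by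
    have h0 : (m : ℝ) * ‖S‖ = ‖(m : ℂ) * S‖ := by simp
    rw [h0, key]
    calc ‖∑ j ∈ Finset.range m, negOneRoot m j ^ a * (E j * inner ℂ (X j) (Y j))‖
        ≤ ∑ j ∈ Finset.range m, 2 * Real.cot (Real.pi / (2 * m)) *
            ((‖X j‖ ^ 2 + ‖Y j‖ ^ 2) / 2) := by
          refine norm_sum_le_of_le _ fun j _ => ?_
          rw [norm_mul, norm_pow, norm_negOneRoot, one_pow, one_mul, norm_mul]
          refine mul_le_mul (hE' j) ?_ (norm_nonneg _) (by positivity)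
          have := norm_inner_le_norm (𝕜 := ℂ) (X j) (Y j)
          nlinarith [sq_nonneg (‖X j‖ - ‖Y j‖)]
      _ = 2 * Real.cot (Real.pi / (2 * m)) *
            ((∑ j ∈ Finset.range m, ‖X j‖ ^ 2 + ∑ j ∈ Finset.range m, ‖Y j‖ ^ 2) / 2) := by
          rw [← Finset.mul_sum, ← Finset.sum_div, Finset.sum_add_distrib]
      _ ≤ _ := by gcongr; linarith
  refine le_of_mul_le_mul_left ?_ hmr
  linarith

end FourierBound

/-! ### Ampliations -/

section Ampliation

variable {ι : Type*} [DecidableEq ι] {d : ι → Type*}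

theorem ampliation_apply (i : ι) (A : HilbSp (d i) →L[ℂ] HilbSp (d i)) (ψ : HilbSp (∀ j, d j))
    (x : ∀ j, d j) : ampliation i A ψ x = A (slice i ψ fun j => x j) (x i) := rfl

theorem piSplitAt_symm_eq_update (i : ι) (x : ∀ j, d j) (t : d i) :
    (Equiv.piSplitAt i d).symm (t, fun j => x j) = Function.update x i t := by
  ext j
  by_cases h : j = i
  · subst h; simp [Equiv.piSplitAt]
  · simp [Equiv.piSplitAt, h]

theorem slice_restrict_apply (i : ι) (ψ : HilbSp (∀ j, d j)) (x : ∀ j, d j) (t : d i) :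
    slice i ψ (fun j => x j) t = ψ (Function.update x i t) :=
  congrArg ψ (piSplitAt_symm_eq_update i x t)

theorem slice_ampliation (i : ι) (A : HilbSp (d i) →L[ℂ] HilbSp (d i)) (ψ : HilbSp (∀ j, d j))
    (y : ∀ j : {j // j ≠ i}, d j) : slice i (ampliation i A ψ) y = A (slice i ψ y) := by
  ext t
  have h := (Equiv.piSplitAt i d).apply_symm_apply (t, y)
  have h1 : (Equiv.piSplitAt i d).symm (t, y) i = t := congrArg Prod.fst h
  have h2 : (fun j : {j // j ≠ i} => (Equiv.piSplitAt i d).symm (t, y) j) = y :=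
    congrArg Prod.snd h
  change A (slice i ψ fun j => (Equiv.piSplitAt i d).symm (t, y) j)
    ((Equiv.piSplitAt i d).symm (t, y) i) = _
  rw [h2, h1]

theorem ampliation_add (i : ι) (A B : HilbSp (d i) →L[ℂ] HilbSp (d i)) :
    ampliation i (A + B) = ampliation i A + ampliation i B := rfl

theorem ampliation_sub (i : ι) (A B : HilbSp (d i) →L[ℂ] HilbSp (d i)) :
    ampliation i (A - B) = ampliation i A - ampliation i B := rfl

theorem ampliation_one (i : ι) :
    ampliation i (1 : HilbSp (d i) →L[ℂ] HilbSp (d i)) = 1 := by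
  ext ψ x
  change slice i ψ (fun j => x j) (x i) = ψ x
  rw [slice_restrict_apply, Function.update_eq_self]

theorem norm_ampliation_le (i : ι) (A : HilbSp (d i) →L[ℂ] HilbSp (d i)) :
    ‖ampliation i A‖ ≤ ‖A‖ := LinearMap.mkContinuous_norm_le _ (norm_nonneg _) _

/-- The space decomposes as the orthogonal sum of the slices in direction `i`. -/
theorem hasSum_inner_slice (i : ι) (ψ φ : HilbSp (∀ j, d j)) :
    HasSum (fun y => inner ℂ (slice i ψ y) (slice i φ y)) (inner ℂ ψ φ) := by
  let e := (Equiv.prodComm (∀ j : {j // j ≠ i}, d j) (d i)).trans (Equiv.piSplitAt i d).symm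
  have h : HasSum (fun q : (∀ j : {j // j ≠ i}, d j) × d i => inner ℂ (ψ (e q)) (φ (e q)))
      (inner ℂ ψ φ) := (e.hasSum_iff).2 (lp.hasSum_inner ψ φ)
  exact h.prod_fiberwise fun y => lp.hasSum_inner (slice i ψ y) (slice i φ y)

theorem inner_ampliation_comm (i : ι) {A : HilbSp (d i) →L[ℂ] HilbSp (d i)}
    (hA : IsSelfAdjoint A) (ψ φ : HilbSp (∀ j, d j)) :
    inner ℂ (ampliation i A ψ) φ = inner ℂ ψ (ampliation i A φ) := by
  refine (hasSum_inner_slice i _ _).unique ?_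
  convert hasSum_inner_slice i ψ (ampliation i A φ) using 2 with y
  rw [slice_ampliation, slice_ampliation]
  exact hA.isSymmetric _ _

theorem isSelfAdjoint_ampliation (i : ι) {A : HilbSp (d i) →L[ℂ] HilbSp (d i)}
    (hA : IsSelfAdjoint A) : IsSelfAdjoint (ampliation i A) := by
  rw [ContinuousLinearMap.isSelfAdjoint_iff_isSymmetric]
  exact fun ψ φ => inner_ampliation_comm i hA ψ φ

end Ampliation

/-! ### Product vectors -/

section ProductVector

variable {ι : Type*} {d : ι → Type*} {p q : ι → Prop}

/-- `ψ = α ⊗ β`, where `α` is a vector of the parties satisfying `p` and `β` one of the parties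
satisfying `q`. It is used with `q` equivalent to the negation of `p`; separate predicates keep the
roles of the two groups symmetric. -/
def IsProductVector (ψ : HilbSp (∀ i, d i)) (α : HilbSp (∀ i : {i // p i}, d i))
    (β : HilbSp (∀ i : {i // q i}, d i)) : Prop :=
  ∀ x : ∀ i, d i, ψ x = α (fun i => x i) * β (fun i => x i)

theorem IsProductVector.symm {ψ : HilbSp (∀ i, d i)} {α : HilbSp (∀ i : {i // p i}, d i)}
    {β : HilbSp (∀ i : {i // q i}, d i)} (h : IsProductVector ψ α β) : IsProductVector ψ β α :=
  fun x => (h x).trans (mul_comm _ _)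

theorem IsProductVector.ext {ψ φ : HilbSp (∀ i, d i)} {α : HilbSp (∀ i : {i // p i}, d i)}
    {β : HilbSp (∀ i : {i // q i}, d i)} (h : IsProductVector ψ α β)
    (h' : IsProductVector φ α β) : ψ = φ := by
  apply lp.ext
  funext x
  rw [h x, h' x]

theorem IsProductVector.inner_eq (hpq : ∀ i, q i ↔ ¬ p i) {ψ φ : HilbSp (∀ i, d i)}
    {α γ : HilbSp (∀ i : {i // p i}, d i)} {β δ : HilbSp (∀ i : {i // q i}, d i)}
    (h : IsProductVector ψ α β) (h' : IsProductVector φ γ δ) :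
    inner ℂ ψ φ = inner ℂ α γ * inner ℂ β δ := by
  classical
  obtain rfl : q = fun i => ¬ p i := funext fun i => propext (hpq i)
  let e := Equiv.piEquivPiSubtypeProd p d
  have h1 : HasSum (fun z => inner ℂ (ψ (e.symm z)) (φ (e.symm z))) (inner ℂ ψ φ) :=
    (e.symm.hasSum_iff).2 (lp.hasSum_inner ψ φ)
  have h2 : (fun z => inner ℂ (ψ (e.symm z)) (φ (e.symm z)))
      = fun z => inner ℂ (α z.1) (γ z.1) * inner ℂ (β z.2) (δ z.2) := by
    funext z
    have e1 : (fun i : {i // p i} => e.symm z i) = z.1 :=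
      congrArg Prod.fst (e.apply_symm_apply z)
    have e2 : (fun i : {i // ¬ p i} => e.symm z i) = z.2 :=
      congrArg Prod.snd (e.apply_symm_apply z)
    rw [h, h', e1, e2]
    simp only [RCLike.inner_apply, map_mul]
    ring
  rw [h2] at h1
  have h3 := (lp.hasSum_inner (𝕜 := ℂ) α γ).mul (lp.hasSum_inner (𝕜 := ℂ) β δ) h1.summable
  exact h1.unique h3

theorem isProductVector_single [DecidableEq (∀ i, d i)] [DecidableEq (∀ i : {i // p i}, d i)]
    [DecidableEq (∀ i : {i // q i}, d i)] (hpq : ∀ i, q i ↔ ¬ p i) (x : ∀ i, d i) (c : ℂ) :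
    IsProductVector (lp.single 2 x c : HilbSp (∀ i, d i))
      (lp.single 2 (fun i : {i // p i} => x i) c : HilbSp (∀ i : {i // p i}, d i))
      (lp.single 2 (fun i : {i // q i} => x i) 1 : HilbSp (∀ i : {i // q i}, d i)) := by
  intro z
  simp only [lp.single_apply, Pi.single_apply]
  by_cases h : z = x
  · subst h; simp
  · rw [if_neg h]
    by_cases h1 : (fun i : {i // p i} => z i) = fun i : {i // p i} => x i
    · rw [if_neg (c := (fun i : {i // q i} => z i) = fun i : {i // q i} => x i), mul_zero]
      intro h2
      refine h (funext fun i => ?_)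
      by_cases hp : p i
      · exact congrFun h1 ⟨i, hp⟩
      · exact congrFun h2 ⟨i, (hpq i).2 hp⟩
    · rw [if_neg h1, zero_mul]

variable [DecidableEq ι]

theorem IsProductVector.ampliation_left (hpq : ∀ i, q i ↔ ¬ p i) {ψ : HilbSp (∀ i, d i)}
    {α : HilbSp (∀ i : {i // p i}, d i)} {β : HilbSp (∀ i : {i // q i}, d i)}
    (h : IsProductVector ψ α β) {i : ι} (hi : p i) (A : HilbSp (d i) →L[ℂ] HilbSp (d i)) :
    IsProductVector (ampliation i A ψ)
      (ampliation (d := fun j : {j // p j} => d j) ⟨i, hi⟩ A α) β := by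
  intro x
  have hs : slice i ψ (fun j => x j) = β (fun j => x j) •
      slice (d := fun j : {j // p j} => d j) ⟨i, hi⟩ α (fun j => x j) := by
    ext t
    rw [slice_restrict_apply, h, lp.coeFn_smul, Pi.smul_apply, smul_eq_mul, mul_comm]
    congr 1
    · refine congrArg β (funext fun j => ?_)
      have : (j : ι) ≠ i := fun hj => (hpq j).1 j.2 (hj ▸ hi)
      simp [this]
    · have := slice_restrict_apply (d := fun j : {j // p j} => d j) ⟨i, hi⟩ α (fun j => x j) t
      refine Eq.trans ?_ this.symm
      refine congrArg α (funext fun j => ?_)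
      by_cases hj : (j : ι) = i
      · obtain rfl : j = ⟨i, hi⟩ := Subtype.ext hj
        simp
      · have : j ≠ ⟨i, hi⟩ := fun h => hj (congrArg Subtype.val h)
        simp [hj, this]
  rw [ampliation_apply, hs, map_smul, lp.coeFn_smul, Pi.smul_apply, smul_eq_mul, mul_comm]
  rfl

theorem IsProductVector.ampliation_right (hpq : ∀ i, q i ↔ ¬ p i) {ψ : HilbSp (∀ i, d i)}
    {α : HilbSp (∀ i : {i // p i}, d i)} {β : HilbSp (∀ i : {i // q i}, d i)}
    (h : IsProductVector ψ α β) {i : ι} (hi : q i) (A : HilbSp (d i) →L[ℂ] HilbSp (d i)) :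
    IsProductVector (ampliation i A ψ) α
      (ampliation (d := fun j : {j // q j} => d j) ⟨i, hi⟩ A β) :=
  (h.symm.ampliation_left (fun i => by rw [hpq, not_not]) hi A).symm

/-- Operators of different parties commute: on the basis vectors, which are product vectors, they
act on different factors. -/
theorem commute_ampliation {i j : ι} (hij : i ≠ j) (A : HilbSp (d i) →L[ℂ] HilbSp (d i))
    (B : HilbSp (d j) →L[ℂ] HilbSp (d j)) : Commute (ampliation i A) (ampliation j B) := by
  classical
  refine lp.ext_continuousLinearMap (ENNReal.ofNat_ne_top (n := nat_lit 2)) fun x => ?_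
  ext1
  have hpq : ∀ k, (k ≠ i) ↔ ¬ (k = i) := fun _ => Iff.rfl
  have h := isProductVector_single (p := fun k => k = i) (q := fun k => k ≠ i) hpq x 1
  exact ((h.ampliation_right hpq (i := j) hij.symm B).ampliation_left hpq rfl A).ext
    ((h.ampliation_left hpq rfl A).ampliation_right hpq (i := j) hij.symm B)

end ProductVector

/-! ### Products of commuting observables -/

section Observables

variable {H : Type*} [NormedAddCommGroup H] [InnerProductSpace ℂ H] {n m : ℕ}

/-- The product of the observables measured by the parties in the list `l` for the settings `s`. -/
noncomputable def observableProd (A : Fin n → Fin m → H →L[ℂ] H) (s : Fin n → Fin m)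
    (l : List (Fin n)) : H →L[ℂ] H := (l.map fun i => A i (s i)).prod

variable {A : Fin n → Fin m → H →L[ℂ] H}

theorem norm_observableProd_le (hA : ∀ i t, ‖A i t‖ ≤ 1) (s : Fin n → Fin m) (l : List (Fin n)) :
    ‖observableProd A s l‖ ≤ 1 := by
  induction l with
  | nil => exact ContinuousLinearMap.norm_id_le
  | cons i l ih =>
    rw [observableProd, List.map_cons, List.prod_cons]
    exact (norm_mul_le _ _).trans (mul_le_one₀ (hA _ _) (norm_nonneg _) ih)

theorem observableProd_congr {s s' : Fin n → Fin m} {l : List (Fin n)}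
    (h : ∀ i ∈ l, s i = s' i) : observableProd A s l = observableProd A s' l := by
  rw [observableProd, observableProd, List.map_congr_left fun i hi => by rw [h i hi]]

theorem observableProd_perm (hA : ∀ i j t u, i ≠ j → Commute (A i t) (A j u))
    (s : Fin n → Fin m) {l l' : List (Fin n)} (hl : l.Nodup) (h : l.Perm l') :
    observableProd A s l = observableProd A s l' :=
  (h.map _).prod_eq' (List.pairwise_map.2 (hl.imp fun hij => hA _ _ _ _ hij))

variable [CompleteSpace H]

theorem isSelfAdjoint_observableProd (hA : ∀ i j t u, i ≠ j → Commute (A i t) (A j u))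
    (hsa : ∀ i t, IsSelfAdjoint (A i t)) (s : Fin n → Fin m) {l : List (Fin n)} (hl : l.Nodup) :
    IsSelfAdjoint (observableProd A s l) := by
  induction l with
  | nil => exact IsSelfAdjoint.one _
  | cons i l ih =>
    have hl := List.nodup_cons.1 hl
    refine ((hsa i (s i)).commute_iff (ih hl.2)).1 (Commute.list_prod_right _ _ fun B hB => ?_)
    obtain ⟨j, hj, rfl⟩ := List.mem_map.1 hB
    exact hA _ _ _ _ fun hij => hl.1 (hij ▸ hj)

/-- The difference of the two effects of a binary measurement is a contraction, because
`‖(a + b) v‖² - ‖(a - b) v‖² = 4 Re ⟪a v, b v⟫` and the positive operators `a`, `b = 1 - a` commute. -/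
theorem norm_sub_le_one_of_isPositive {a b : H →L[ℂ] H} (ha : a.IsPositive) (hb : b.IsPositive)
    (hab : a + b = 1) : ‖a - b‖ ≤ 1 := by
  refine ContinuousLinearMap.opNorm_le_bound _ zero_le_one fun v => ?_
  have hv : ∀ w, a w + b w = w := fun w => congrArg (fun f : H →L[ℂ] H => f w) hab
  have hre : 0 ≤ (inner ℂ (a v) (b v)).re := by
    have h1 : inner ℂ (a v) (b v) = inner ℂ (a v) (b (a v)) + inner ℂ (a (b v)) (b v) := by
      have h2 : a (b v) = b (a v) := by
        have e1 : a (b v) = b v - b (b v) := by rw [eq_sub_iff_add_eq, hv]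
        have e2 : b v = b (a v) + b (b v) := by rw [← map_add, hv]
        rw [e1]; nth_rewrite 1 [e2]; abel
      have h3 : inner ℂ (a (b v)) (b v) = inner ℂ (a v) (b (b v)) := by
        rw [h2]; exact hb.isSelfAdjoint.isSymmetric _ _
      rw [h3, ← inner_add_right, ← map_add, hv]
    rw [h1, Complex.add_re]
    exact add_nonneg (Complex.le_def.1 (hb.inner_nonneg_right (a v))).1
      (Complex.le_def.1 (ha.inner_nonneg_left (b v))).1
  have e1 := norm_add_sq (𝕜 := ℂ) (a v) (b v)
  have e2 := norm_sub_sq (𝕜 := ℂ) (a v) (b v)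
  rw [hv] at e1
  simp only [RCLike.re_to_complex] at e1 e2
  rw [one_mul, sub_apply]
  exact le_of_sq_le_sq (by linarith) (norm_nonneg _)

end Observables

/-! ### Sums over settings -/

section Settings

variable {n m : ℕ}

theorem sum_sum_update (i : Fin n) (F : (Fin n → Fin m) → ℝ) :
    ∑ s, ∑ t, F (Function.update s i t) = m * ∑ s, F s := by
  let e : (Fin n → Fin m) × Fin m ≃ (Fin n → Fin m) × Fin m :=
    { toFun := fun z => (Function.update z.1 i z.2, z.1 i)
      invFun := fun z => (Function.update z.1 i z.2, z.1 i)
      left_inv := fun z => by simp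
      right_inv := fun z => by simp }
  have h := e.sum_comp fun z => F z.1
  rw [Fintype.sum_prod_type, Fintype.sum_prod_type] at h
  change ∑ s, ∑ t, F (Function.update s i t) = _ at h
  rw [h, Finset.mul_sum]
  simp

theorem sum_val_update (s : Fin n → Fin m) (i : Fin n) (t : Fin m) :
    (∑ j, (Function.update s i t j : ℕ)) + s i = (∑ j, (s j : ℕ)) + t := by
  have e : ∀ j, (Function.update s i t j : ℕ) = Function.update (fun j => (s j : ℕ)) i t j :=
    fun j => by
      by_cases h : j = i
      · subst h; simp
      · simp [h]
  simp only [e]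
  rw [Finset.sum_update_of_mem (Finset.mem_univ i), Finset.sdiff_singleton_eq_erase,
    ← Finset.add_sum_erase _ (fun j => (s j : ℕ)) (Finset.mem_univ i)]
  ring

/-- Every residue modulo `m` is attained equally often by the sum of the settings: with the other
settings fixed, exactly one value of a single setting gives it. -/
theorem sum_filter_mod_one (hn : 0 < n) {a : ℕ} (ha : a < m) :
    ∑ s : Fin n → Fin m with (∑ i, (s i : ℕ)) % m = a, (1 : ℝ) = (m : ℝ) ^ (n - 1) := by
  have hm : (0 : ℝ) < m := by exact_mod_cast (by omega : 0 < m)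
  rw [Finset.sum_filter]
  have h := sum_sum_update (m := m) (⟨0, hn⟩ : Fin n)
    (fun s => if (∑ i, (s i : ℕ)) % m = a then 1 else 0)
  have h1 : ∀ s : Fin n → Fin m, ∑ t : Fin m,
      (if (∑ i, (Function.update s ⟨0, hn⟩ t i : ℕ)) % m = a then (1 : ℝ) else 0) = 1 := by
    intro s
    have hu : ∃! t : Fin m, (∑ i, (Function.update s ⟨0, hn⟩ t i : ℕ)) % m = a := by
      have hsi : (s ⟨0, hn⟩ : ℕ) ≤ ∑ i, (s i : ℕ) :=
        Finset.single_le_sum (f := fun i => (s i : ℕ)) (fun _ _ => Nat.zero_le _) (Finset.mem_univ _)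
      set b := (∑ i, (s i : ℕ)) - s ⟨0, hn⟩ with hb
      have hbt : ∀ t : Fin m, (∑ i, (Function.update s ⟨0, hn⟩ t i : ℕ)) = b + t := fun t => by
        have := sum_val_update s ⟨0, hn⟩ t
        omega
      simp only [hbt]
      have hm0 : 0 < m := by omega
      have hb' := Nat.mod_lt b hm0
      have hv : (b + (a + (m - b % m)) % m) % m = a := by
        rw [Nat.add_mod_mod, ← Nat.mod_add_mod, show b % m + (a + (m - b % m)) = a + m by omega,
          Nat.add_mod_right, Nat.mod_eq_of_lt ha]
      refine ⟨⟨(a + (m - b % m)) % m, Nat.mod_lt _ hm0⟩, hv, fun u hu => ?_⟩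
      ext
      have h := Nat.ModEq.add_left_cancel' b (hu.trans hv.symm : _ ≡ _ [MOD m])
      rwa [Nat.ModEq, Nat.mod_eq_of_lt u.2, Nat.mod_mod] at h
    obtain ⟨t, ht, htu⟩ := hu
    rw [Finset.sum_eq_single t (fun u _ hu => if_neg fun h => hu (htu u h)) (by simp), if_pos ht]
  simp only [h1] at h
  have h2 : (∑ _s : Fin n → Fin m, (1 : ℝ)) = m * (m : ℝ) ^ (n - 1) := by
    rw [← pow_succ', Nat.sub_add_cancel hn]; simp
  rw [h2] at h
  exact (mul_left_cancel₀ hm.ne' h).symm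

end Settings

/-! ### The bound for a product vector -/

section ProductBound

variable {H : Type*} [NormedAddCommGroup H] [InnerProductSpace ℂ H] [CompleteSpace H] {n m : ℕ}
  {A : Fin n → Fin m → H →L[ℂ] H}

/-- If the expectations of the products of observables factorize between two groups of parties, the
second with at least two members, then freezing the settings of all but one party of the first and
two parties of the second group reduces the Bell expression to the tripartite bound. -/
theorem sum_bellSign_mul_re_inner_le (hm : 2 ≤ m)
    (hcomm : ∀ i j t u, i ≠ j → Commute (A i t) (A j u)) (hsa : ∀ i t, IsSelfAdjoint (A i t))
    (hA : ∀ i t, ‖A i t‖ ≤ 1) {ψ : H} (hψ : ‖ψ‖ = 1) {i₁ i₂ i₃ : Fin n} {l l' : List (Fin n)}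
    (hl : ((i₁ :: l) ++ (i₂ :: i₃ :: l')).Perm (List.finRange n))
    (hfac : ∀ s, inner ℂ ψ (observableProd A s (i₁ :: l) (observableProd A s (i₂ :: i₃ :: l') ψ)) =
      inner ℂ ψ (observableProd A s (i₁ :: l) ψ) *
        inner ℂ ψ (observableProd A s (i₂ :: i₃ :: l') ψ)) :
    ∑ s : Fin n → Fin m, bellSign m (∑ i, (s i : ℕ)) *
      (inner ℂ ψ (observableProd A s (List.finRange n) ψ)).re ≤
      2 * (m : ℝ) ^ (n - 2) * Real.cot (Real.pi / (2 * m)) := by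
  have hnd := (hl.nodup_iff).2 (List.nodup_finRange n)
  have hlen := hl.length_eq
  simp only [List.length_append, List.length_cons, List.length_finRange] at hlen
  have hnd' := List.nodup_append.1 hnd
  have hmr : (0 : ℝ) < m := by exact_mod_cast (by omega : 0 < m)
  obtain ⟨hnd1, hnd2, hdis⟩ := hnd'
  have h12 : i₁ ≠ i₂ := hdis _ (by simp) _ (by simp)
  have h13 : i₁ ≠ i₃ := hdis _ (by simp) _ (by simp)
  have h23 : i₂ ≠ i₃ := by simp only [List.nodup_cons, List.mem_cons] at hnd2; tauto
  set F : (Fin n → Fin m) → ℝ := fun s => bellSign m (∑ i, (s i : ℕ)) *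
      (inner ℂ ψ (observableProd A s (List.finRange n) ψ)).re with hF
  have hF' : ∀ s, F s = (bellSign m (∑ i, (s i : ℕ)) *
      (inner ℂ ψ (observableProd A s (i₁ :: l) ψ) *
        inner ℂ ψ (observableProd A s (i₂ :: i₃ :: l') ψ)) : ℂ).re := fun s => by
    rw [← hfac, Complex.re_ofReal_mul]
    simp only [hF]
    rw [← observableProd_perm hcomm s hnd hl]
    simp only [observableProd, List.map_append, List.prod_append]
    rw [mul_apply_eq_comp]
  have hloc : ∀ s : Fin n → Fin m, ∑ t₁, ∑ t₂, ∑ t₃,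
      F (Function.update (Function.update (Function.update s i₁ t₁) i₂ t₂) i₃ t₃) ≤
        2 * m * Real.cot (Real.pi / (2 * m)) := by
    intro s
    obtain ⟨a, ha⟩ : ∃ a, ∀ t₁ t₂ t₃ : Fin m, (∑ i, (Function.update (Function.update
        (Function.update s i₁ t₁) i₂ t₂) i₃ t₃ i : ℕ)) = a + t₁ + t₂ + t₃ := by
      have key : ∀ t₁ t₂ t₃ : Fin m, (∑ i, (Function.update (Function.update
        (Function.update s i₁ t₁) i₂ t₂) i₃ t₃ i : ℕ)) + (s i₁ + s i₂ + s i₃)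
          = (∑ i, (s i : ℕ)) + t₁ + t₂ + t₃ := by
        intro t₁ t₂ t₃
        have k1 := sum_val_update s i₁ t₁
        have k2 := sum_val_update (Function.update s i₁ t₁) i₂ t₂
        have k3 := sum_val_update (Function.update (Function.update s i₁ t₁) i₂ t₂) i₃ t₃
        rw [Function.update_of_ne h12.symm] at k2
        rw [Function.update_of_ne h23.symm, Function.update_of_ne h13.symm] at k3
        omega
      have k0 := key ⟨0, by omega⟩ ⟨0, by omega⟩ ⟨0, by omega⟩
      refine ⟨(∑ i, (s i : ℕ)) - (s i₁ + s i₂ + s i₃), fun t₁ t₂ t₃ => ?_⟩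
      have := key t₁ t₂ t₃
      simp only [add_zero] at k0
      omega
    -- the first group acts as a party with real answers in `[-1, 1]`, by self-adjointness
    set e : Fin m → ℝ := fun t =>
      (inner ℂ ψ (observableProd A (Function.update s i₁ t) (i₁ :: l) ψ)).re with he
    have he' : ∀ t₁ t₂ t₃, inner ℂ ψ (observableProd A (Function.update (Function.update
        (Function.update s i₁ t₁) i₂ t₂) i₃ t₃) (i₁ :: l) ψ) = e t₁ := by
      intro t₁ t₂ t₃
      rw [observableProd_congr (s' := Function.update s i₁ t₁)]
      · have := (isSelfAdjoint_observableProd hcomm hsa (Function.update s i₁ t₁)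
          hnd1).isSymmetric
        exact (this.coe_re_inner_self_apply ψ).symm
      · intro i hi
        rw [Function.update_of_ne (hdis i hi i₃ (by simp)),
          Function.update_of_ne (hdis i hi i₂ (by simp))]
    have hB : ∀ B : H →L[ℂ] H, ‖B‖ ≤ 1 → ∀ v : H, ‖v‖ ≤ 1 → ‖B v‖ ≤ 1 := fun B hB v hv =>
      (B.le_opNorm v).trans (mul_le_one₀ hB (norm_nonneg _) hv)
    have he1 : ∀ t, |e t| ≤ 1 := fun t => by
      refine (Complex.abs_re_le_norm _).trans ((norm_inner_le_norm _ _).trans ?_)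
      rw [hψ, one_mul]
      exact hB _ (norm_observableProd_le hA _ _) _ hψ.le
    set R := observableProd A s l' with hR
    have hxy : ∀ t₁ t₂ t₃, inner ℂ ψ (observableProd A (Function.update (Function.update
        (Function.update s i₁ t₁) i₂ t₂) i₃ t₃) (i₂ :: i₃ :: l') ψ) =
          inner ℂ (A i₂ t₂ ψ) (A i₃ t₃ (R ψ)) := by
      intro t₁ t₂ t₃
      have h1 : observableProd A (Function.update (Function.update
          (Function.update s i₁ t₁) i₂ t₂) i₃ t₃) (i₂ :: i₃ :: l') = A i₂ t₂ * (A i₃ t₃ * R) := by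
        rw [hR, ← observableProd_congr (s := Function.update (Function.update
          (Function.update s i₁ t₁) i₂ t₂) i₃ t₃) (s' := s)]
        · simp [observableProd, h23]
        · intro i hi
          simp only [List.nodup_cons, List.mem_cons, not_or] at hnd2
          rw [Function.update_of_ne (ne_of_mem_of_not_mem hi hnd2.2.1),
            Function.update_of_ne (ne_of_mem_of_not_mem hi hnd2.1.2),
            Function.update_of_ne (hdis i₁ (by simp) i (by simp [hi])).symm]
      rw [h1]
      exact ((hsa i₂ t₂).isSymmetric ψ (A i₃ t₃ (R ψ))).symm
    have core := norm_sum_bellSign_mul_inner_le hm a e he1 (fun t => A i₂ t ψ)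
      (fun t => A i₃ t (R ψ)) (fun t => hB _ (hA _ _) _ hψ.le)
      (fun t => hB _ (hA _ _) _ (hB _ (norm_observableProd_le hA _ _) _ hψ.le))
    refine le_trans (le_of_eq ?_) ((Complex.re_le_norm _).trans core)
    simp only [Complex.re_sum]
    refine Finset.sum_congr rfl fun t₁ _ => Finset.sum_congr rfl fun t₂ _ =>
      Finset.sum_congr rfl fun t₃ _ => ?_
    rw [hF', ha, he', hxy]
  -- summing over all settings and three re-chosen ones counts every setting `m ^ 3` times
  have htot : (m : ℝ) * (m * (m * ∑ s, F s)) ≤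
      (m : ℝ) ^ n * (2 * m * Real.cot (Real.pi / (2 * m))) := by
    rw [← sum_sum_update i₃, ← sum_sum_update i₂, ← sum_sum_update i₁]
    calc _ ≤ ∑ _s : Fin n → Fin m, 2 * m * Real.cot (Real.pi / (2 * m)) :=
          Finset.sum_le_sum fun s _ => hloc s
      _ = _ := by simp
  have hpow : (m : ℝ) ^ n = m ^ (n - 2) * (m * m) := by
    rw [← pow_two, ← pow_add]; congr 1; omega
  rw [hpow] at htot
  refine le_of_mul_le_mul_left ?_ (mul_pos hmr (mul_pos hmr hmr))
  linarith

end ProductBound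

/-! ### The Bell expression in terms of correlators -/

theorem List.sum_prod_ofFn {R : Type*} [Semiring R] {n k : ℕ} (f : Fin n → Fin k → R) :
    ∑ r : Fin n → Fin k, (List.ofFn fun i => f i (r i)).prod =
      (List.ofFn fun i => ∑ b, f i b).prod := by
  induction n with
  | zero => simp
  | succ n ih =>
    rw [← (Fin.consEquiv fun _ => Fin k).sum_comp, Fintype.sum_prod_type]
    simp only [List.ofFn_succ, List.prod_cons, Fin.consEquiv_apply, Fin.cons_zero, Fin.cons_succ]
    rw [← ih, Finset.sum_mul]
    simp only [Finset.mul_sum]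

theorem List.prod_ofFn_smul {R : Type*} [Ring R] [Algebra ℂ R] {n : ℕ} (c : Fin n → ℂ)
    (f : Fin n → R) : (List.ofFn fun i => c i • f i).prod = (∏ i, c i) • (List.ofFn f).prod := by
  induction n with
  | zero => simp
  | succ n ih =>
    simp only [List.ofFn_succ, List.prod_cons, ih, Fin.prod_univ_succ, smul_mul_smul_comm]

/-- The full correlator: the expectation of the product of the `±1`-valued outcomes `(-1) ^ r i`. -/
noncomputable def correlator {n m : ℕ} (P : (Fin n → Fin m) → (Fin n → Fin 2) → ℝ)
    (s : Fin n → Fin m) : ℝ := ∑ o, (-1) ^ (∑ i, (o i : ℕ)) * P s o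

theorem sumProb_eq {n m : ℕ} {P : (Fin n → Fin m) → (Fin n → Fin 2) → ℝ} {s : Fin n → Fin m}
    (hP : ∑ o, P s o = 1) : sumProb P s 0 = (1 + correlator P s) / 2 ∧
      sumProb P s 1 = (1 - correlator P s) / 2 := by
  rw [← hP, correlator, ← Finset.sum_add_distrib, ← Finset.sum_sub_distrib, Finset.sum_div,
    Finset.sum_div, sumProb, sumProb, Finset.sum_filter, Finset.sum_filter]
  constructor <;> refine Finset.sum_congr rfl fun o _ => ?_ <;>
  rcases Nat.even_or_odd (∑ i, (o i : ℕ)) with h | h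
  · rw [if_pos (Nat.even_iff.1 h), h.neg_one_pow]; ring
  · rw [if_neg (by rw [Nat.odd_iff.1 h]; norm_num), h.neg_one_pow]; ring
  · rw [if_neg (by rw [Nat.even_iff.1 h]; norm_num), h.neg_one_pow]; ring
  · rw [if_pos (Nat.odd_iff.1 h), h.neg_one_pow]; ring

/-- For binary outcomes both coefficients `[r - f]₂` and `[-r + f]₂` are `1` if `r ≢ f (mod 2)` and
`0` otherwise. -/
theorem sum_range_two_bellCoeff {b : ℝ} (f : ℕ) (g : ℕ → ℝ) (h0 : g 0 = (1 + b) / 2)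
    (h1 : g 1 = (1 - b) / 2) :
    ∑ r ∈ Finset.range 2, ((((r : ℤ) - (f : ℤ)) % ((2 : ℕ) : ℤ) : ℤ) : ℝ) * g r =
      (1 - (-1) ^ f * b) / 2 ∧
    ∑ r ∈ Finset.range 2, (((-(r : ℤ) + (f : ℤ)) % ((2 : ℕ) : ℤ) : ℤ) : ℝ) * g r =
      (1 - (-1) ^ f * b) / 2 := by
  rw [Finset.sum_range_succ, Finset.sum_range_one, Finset.sum_range_succ, Finset.sum_range_one,
    h0, h1]
  rcases Nat.even_or_odd f with h | h
  · have h2 := Nat.even_iff.1 h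
    rw [h.neg_one_pow, show ((0 : ℕ) - f : ℤ) % (2 : ℕ) = 0 by omega,
      show ((1 : ℕ) - f : ℤ) % (2 : ℕ) = 1 by omega, show (-(0 : ℕ) + f : ℤ) % (2 : ℕ) = 0 by omega,
      show (-(1 : ℕ) + f : ℤ) % (2 : ℕ) = 1 by omega]
    constructor <;> push_cast <;> ring
  · have h2 := Nat.odd_iff.1 h
    rw [h.neg_one_pow, show ((0 : ℕ) - f : ℤ) % (2 : ℕ) = 1 by omega,
      show ((1 : ℕ) - f : ℤ) % (2 : ℕ) = 0 by omega, show (-(0 : ℕ) + f : ℤ) % (2 : ℕ) = 1 by omega,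
      show (-(1 : ℕ) + f : ℤ) % (2 : ℕ) = 0 by omega]
    constructor <;> push_cast <;> ring

theorem bellOmega_two_eq {n m : ℕ} (hn : 0 < n) (hm : 2 ≤ m)
    {P : (Fin n → Fin m) → (Fin n → Fin 2) → ℝ} (hP : ∀ s, ∑ o, P s o = 1) :
    bellOmega n m 2 P = (m : ℝ) ^ (n - 1) -
      (∑ s : Fin n → Fin m, bellSign m (∑ i, (s i : ℕ)) * correlator P s) / 2 := by
  have hsum : ∀ s : Fin n → Fin m, bellSign m (∑ i, (s i : ℕ)) * correlator P s =
      (if (∑ i, (s i : ℕ)) % m = 0 then (-1) ^ ((∑ i, (s i : ℕ)) / m) * correlator P s else 0) +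
      (if (∑ i, (s i : ℕ)) % m = 1 then (-1) ^ ((∑ i, (s i : ℕ)) / m) * correlator P s else 0) := by
    intro s
    rw [bellSign]
    by_cases h0 : (∑ i, (s i : ℕ)) % m = 0
    · rw [if_pos (Or.inl h0), if_pos h0, if_neg (by omega), add_zero]
    · by_cases h1 : (∑ i, (s i : ℕ)) % m = 1
      · rw [if_pos (Or.inr h1), if_neg h0, if_pos h1, zero_add]
      · rw [if_neg (by tauto), if_neg h0, if_neg h1]; ring
  have hcoef := fun s => sum_range_two_bellCoeff ((∑ i, (s i : ℕ)) / m) (sumProb P s)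
    (sumProb_eq (hP s)).1 (sumProb_eq (hP s)).2
  rw [bellOmega, Finset.sum_congr rfl fun s _ => (hcoef s).1,
    Finset.sum_congr rfl fun s _ => (hcoef s).2, Finset.sum_congr rfl fun s _ => hsum s,
    Finset.sum_add_distrib, ← Finset.sum_filter, ← Finset.sum_filter, ← Finset.sum_div,
    ← Finset.sum_div, Finset.sum_sub_distrib, Finset.sum_sub_distrib,
    sum_filter_mod_one hn (by omega : 0 < m), sum_filter_mod_one hn (by omega : 1 < m)]
  ring

/-! ### Biseparable correlations -/

section Correlations

variable {n m : ℕ} {d : Fin n → Type u}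

/-- The `±1`-valued observable of a binary measurement, acting on the tensor factor of its party. -/
noncomputable def observable (M : ∀ i, Fin m → POVM 2 (d i)) (i : Fin n) (t : Fin m) :
    HilbSp (∀ i, d i) →L[ℂ] HilbSp (∀ i, d i) :=
  ampliation i ((M i t).effect 0 - (M i t).effect 1)

theorem isSelfAdjoint_observable (M : ∀ i, Fin m → POVM 2 (d i)) (i : Fin n) (t : Fin m) :
    IsSelfAdjoint (observable M i t) :=
  isSelfAdjoint_ampliation i
    (((M i t).isPositive 0).isSelfAdjoint.sub ((M i t).isPositive 1).isSelfAdjoint)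

theorem norm_observable_le (M : ∀ i, Fin m → POVM 2 (d i)) (i : Fin n) (t : Fin m) :
    ‖observable M i t‖ ≤ 1 :=
  (norm_ampliation_le _ _).trans (norm_sub_le_one_of_isPositive ((M i t).isPositive 0)
    ((M i t).isPositive 1) (by rw [← Fin.sum_univ_two, (M i t).sum_eq_one]))

theorem commute_observable (M : ∀ i, Fin m → POVM 2 (d i)) (i j : Fin n) (t u : Fin m)
    (hij : i ≠ j) : Commute (observable M i t) (observable M j u) :=
  commute_ampliation hij _ _

theorem sum_jointEffect (M : ∀ i, Fin m → POVM 2 (d i)) (s : Fin n → Fin m) :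
    ∑ r, jointEffect M s r = 1 := by
  have h : ∀ i, ∑ b, ampliation i ((M i (s i)).effect b) = 1 := fun i => by
    rw [Fin.sum_univ_two, ← ampliation_add, ← Fin.sum_univ_two, (M i (s i)).sum_eq_one,
      ampliation_one]
  simp only [jointEffect]
  rw [List.sum_prod_ofFn fun i b => ampliation i ((M i (s i)).effect b)]
  simp [h, List.ofFn_const]

/-- Summing the joint effects with the signs of the outcomes multiplies out to the product of the
observables. -/
theorem sum_sign_smul_jointEffect (M : ∀ i, Fin m → POVM 2 (d i)) (s : Fin n → Fin m) :
    ∑ r : Fin n → Fin 2, ((-1 : ℂ) ^ (∑ i, (r i : ℕ))) • jointEffect M s r =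
      observableProd (observable M) s (List.finRange n) := by
  have h : ∀ i, ∑ b : Fin 2, ((-1 : ℂ) ^ (b : ℕ)) • ampliation i ((M i (s i)).effect b) =
      observable M i (s i) := fun i => by
    rw [Fin.sum_univ_two, observable, ampliation_sub]
    simp [sub_eq_add_neg]
  rw [observableProd, ← List.ofFn_eq_map]
  simp only [← h]
  rw [← List.sum_prod_ofFn fun i (b : Fin 2) =>
    ((-1 : ℂ) ^ (b : ℕ)) • ampliation i ((M i (s i)).effect b)]
  refine Finset.sum_congr rfl fun r _ => ?_
  rw [List.prod_ofFn_smul, Finset.prod_pow_eq_pow_sum]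
  rfl

/-- Observables of the first group act on the first factor only. -/
theorem IsProductVector.exists_observableProd {p q : Fin n → Prop} (hpq : ∀ i, q i ↔ ¬ p i)
    (M : ∀ i, Fin m → POVM 2 (d i)) (s : Fin n → Fin m) {l : List (Fin n)} (hl : ∀ i ∈ l, p i)
    (α : HilbSp (∀ i : {i // p i}, d i)) :
    ∃ α' : HilbSp (∀ i : {i // p i}, d i), ∀ (ψ : HilbSp (∀ i, d i))
      (β : HilbSp (∀ i : {i // q i}, d i)), IsProductVector ψ α β →
        IsProductVector (observableProd (observable M) s l ψ) α' β := by
  induction l with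
  | nil => exact ⟨α, fun ψ β h => h⟩
  | cons i l ih =>
    obtain ⟨α', h'⟩ := ih fun j hj => hl j (List.mem_cons_of_mem _ hj)
    refine ⟨ampliation (d := fun j : {j // p j} => d j) ⟨i, hl i (List.mem_cons_self ..)⟩
      ((M i (s i)).effect 0 - (M i (s i)).effect 1) α',
      fun ψ β h => ?_⟩
    rw [observableProd, List.map_cons, List.prod_cons]
    exact (h' ψ β h).ampliation_left hpq (hl i (List.mem_cons_self ..)) _

/-- In a product state, the expectations of products of observables factorize between the groups. -/
theorem IsProductVector.inner_observableProd_mul {p q : Fin n → Prop} (hpq : ∀ i, q i ↔ ¬ p i)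
    (M : ∀ i, Fin m → POVM 2 (d i)) (s : Fin n → Fin m) {l l' : List (Fin n)}
    (hl : ∀ i ∈ l, p i) (hl' : ∀ i ∈ l', q i) {ψ : HilbSp (∀ i, d i)}
    {α : HilbSp (∀ i : {i // p i}, d i)} {β : HilbSp (∀ i : {i // q i}, d i)}
    (h : IsProductVector ψ α β) (hψ : ‖ψ‖ = 1) :
    inner ℂ ψ (observableProd (observable M) s l (observableProd (observable M) s l' ψ)) =
      inner ℂ ψ (observableProd (observable M) s l ψ) *
        inner ℂ ψ (observableProd (observable M) s l' ψ) := by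
  obtain ⟨α', hα⟩ := IsProductVector.exists_observableProd hpq M s hl α
  obtain ⟨β', hβ⟩ := IsProductVector.exists_observableProd (q := p)
    (fun i => by rw [hpq, not_not]) M s hl' β
  have h2 := (hβ ψ α h.symm).symm
  have h1 := inner_self_eq_norm_sq_to_K (𝕜 := ℂ) ψ
  rw [hψ, h.inner_eq hpq h] at h1
  rw [h.inner_eq hpq (hα _ _ h2), h.inner_eq hpq (hα _ _ h), h.inner_eq hpq h2]
  simp only [RCLike.ofReal_one, one_pow] at h1
  linear_combination (-(inner ℂ α α' * inner ℂ β β')) * h1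

/-- The pointwise bound when the second group of parties has at least two members. -/
theorem IsProductVector.sum_bellSign_le (hm : 2 ≤ m) {p q : Fin n → Prop}
    (hpq : ∀ i, q i ↔ ¬ p i) (M : ∀ i, Fin m → POVM 2 (d i)) {ψ : HilbSp (∀ i, d i)}
    {α : HilbSp (∀ i : {i // p i}, d i)} {β : HilbSp (∀ i : {i // q i}, d i)}
    (h : IsProductVector ψ α β) (hψ : ‖ψ‖ = 1) {i₁ i₂ i₃ : Fin n} (h1 : p i₁) (h2 : q i₂)
    (h3 : q i₃) (h23 : i₂ ≠ i₃) :
    ∑ s : Fin n → Fin m, bellSign m (∑ i, (s i : ℕ)) *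
      (inner ℂ ψ (observableProd (observable M) s (List.finRange n) ψ)).re ≤
      2 * (m : ℝ) ^ (n - 2) * Real.cot (Real.pi / (2 * m)) := by
  classical
  have key := List.filter_append_perm (fun i => decide (p i)) (List.finRange n)
  set L := (List.finRange n).filter (fun i => decide (p i)) with hL
  set L' := (List.finRange n).filter (fun i => !decide (p i)) with hL'
  have m1 : i₁ ∈ L := by simp [hL, h1]
  have m2 : i₂ ∈ L' := by simp [hL', (hpq _).1 h2]
  have m3 : i₃ ∈ L'.erase i₂ := (List.mem_erase_of_ne h23.symm).2 (by simp [hL', (hpq _).1 h3])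
  have p1 := List.perm_cons_erase m1
  have p2 := (List.perm_cons_erase m2).trans ((List.perm_cons_erase m3).cons i₂)
  refine sum_bellSign_mul_re_inner_le hm (commute_observable M) (isSelfAdjoint_observable M)
    (norm_observable_le M) hψ ((p1.append p2).symm.trans key) fun s =>
    h.inner_observableProd_mul hpq M s (fun i hi => ?_) (fun i hi => ?_) hψ
  · have := p1.mem_iff.2 hi
    simpa [hL] using this
  · have := p2.mem_iff.2 hi
    rw [hpq]
    simpa [hL'] using this

theorem IsBiseparablePure.sum_bellSign_le (hn : 3 ≤ n) (hm : 2 ≤ m)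
    (M : ∀ i, Fin m → POVM 2 (d i)) {ψ : HilbSp (∀ i, d i)} (h : IsBiseparablePure ψ)
    (hψ : ‖ψ‖ = 1) :
    ∑ s : Fin n → Fin m, bellSign m (∑ i, (s i : ℕ)) *
      (inner ℂ ψ (observableProd (observable M) s (List.finRange n) ψ)).re ≤
      2 * (m : ℝ) ^ (n - 2) * Real.cot (Real.pi / (2 * m)) := by
  obtain ⟨G, ⟨i, hi⟩, ⟨j, hj⟩, α, β, hprod⟩ := h
  rw [Finset.mem_compl] at hj
  have hv : IsProductVector (p := fun i => i ∈ G) (q := fun i => i ∉ G) ψ α β := hprod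
  -- one of the two groups contains a third party
  obtain ⟨k, hk⟩ : ∃ k, k ∉ ({i, j} : Finset (Fin n)) := by
    by_contra! hc
    have h1 := Finset.card_le_card (fun x _ => hc x : Finset.univ ⊆ ({i, j} : Finset (Fin n)))
    have h2 := Finset.card_le_two (a := i) (b := j)
    simp only [Finset.card_univ, Fintype.card_fin] at h1
    omega
  simp only [Finset.mem_insert, Finset.mem_singleton, not_or] at hk
  by_cases hkG : k ∈ G
  · exact hv.symm.sum_bellSign_le hm (fun _ => by rw [not_not]) M hψ hj hi hkG (Ne.symm hk.1)
  · exact hv.sum_bellSign_le hm (fun _ => Iff.rfl) M hψ hi hj hkG (Ne.symm hk.2)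

/-- The correlators of a mixture are averages over its pure states, so the pointwise bound integrates
to the bound on the Bell expression. -/
theorem IsBiseparableCorrelation.bellOmega_ge (hn : 3 ≤ n) (hm : 2 ≤ m)
    {P : (Fin n → Fin m) → (Fin n → Fin 2) → ℝ} (hP : IsBiseparableCorrelation.{u, v} P) :
    (m : ℝ) ^ (n - 2) * ((m : ℝ) - Real.cot (Real.pi / (2 * m))) ≤ bellOmega n m 2 P := by
  obtain ⟨d, M, Λ, _, μ, ψ, _, hmeas, hψ, hPψ⟩ := hP
  have hint : ∀ B : HilbSp (∀ i, d i) →L[ℂ] HilbSp (∀ i, d i),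
      MeasureTheory.Integrable (fun l => inner ℂ (ψ l) (B (ψ l))) μ := fun B => by
    refine MeasureTheory.Integrable.of_bound
      (hmeas.inner (B.continuous.comp_aestronglyMeasurable hmeas)) ‖B‖ ?_
    filter_upwards [hψ] with l hl
    refine (norm_inner_le_norm _ _).trans ?_
    rw [hl.1, one_mul]
    simpa [hl.1] using B.le_opNorm (ψ l)
  have hsum : ∀ (s : Fin n → Fin m) (c : (Fin n → Fin 2) → ℂ), ∑ r, c r * (P s r : ℂ) =
      ∫ l, inner ℂ (ψ l) ((∑ r, c r • jointEffect M s r) (ψ l)) ∂μ := fun s c => by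
    simp only [hPψ, ← MeasureTheory.integral_const_mul]
    rw [← MeasureTheory.integral_finsetSum _ fun r _ => (hint _).const_mul _]
    refine MeasureTheory.integral_congr_ae (Filter.Eventually.of_forall fun l => ?_)
    simp
  have hone : ∀ s, ∑ r, P s r = 1 := fun s => by
    have h := hsum s 1
    simp only [Pi.one_apply, one_mul, one_smul, sum_jointEffect, one_apply_eq_self] at h
    rw [MeasureTheory.integral_congr_ae (g := fun _ => (1 : ℂ))] at h
    · simp only [MeasureTheory.integral_const, MeasureTheory.probReal_univ, one_smul] at h
      exact_mod_cast h
    · filter_upwards [hψ] with l hl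
      rw [inner_self_eq_norm_sq_to_K, hl.1]; simp
  have hcorr : ∀ s, correlator P s =
      ∫ l, (inner ℂ (ψ l) (observableProd (observable M) s (List.finRange n) (ψ l))).re ∂μ :=
    fun s => by
      have h := hsum s fun r => (-1) ^ (∑ i, (r i : ℕ))
      rw [sum_sign_smul_jointEffect] at h
      have h' := congrArg Complex.re h
      have hre := integral_re (𝕜 := ℂ)
        (hint (observableProd (observable M) s (List.finRange n)))
      simp only [RCLike.re_to_complex] at hre
      rw [hre, ← h', correlator, ← Complex.ofReal_re (∑ o, _)]
      push_cast
      rfl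
  have hbound : ∑ s : Fin n → Fin m, bellSign m (∑ i, (s i : ℕ)) * correlator P s ≤
      2 * (m : ℝ) ^ (n - 2) * Real.cot (Real.pi / (2 * m)) := by
    have hint' : ∀ s : Fin n → Fin m, MeasureTheory.Integrable (fun l => bellSign m (∑ i, (s i : ℕ)) *
        (inner ℂ (ψ l) (observableProd (observable M) s (List.finRange n) (ψ l))).re) μ :=
      fun s => (hint _).re.const_mul _
    simp only [hcorr, ← MeasureTheory.integral_const_mul]
    rw [← MeasureTheory.integral_finsetSum _ fun s _ => hint' s]
    calc _ ≤ ∫ _l, 2 * (m : ℝ) ^ (n - 2) * Real.cot (Real.pi / (2 * m)) ∂μ := by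
          refine MeasureTheory.integral_mono_ae
            (MeasureTheory.integrable_finsetSum _ fun s _ => hint' s)
            (MeasureTheory.integrable_const _) ?_
          filter_upwards [hψ] with l hl
          exact hl.2.sum_bellSign_le hn hm M hl.1
      _ = _ := by simp
  rw [bellOmega_two_eq (by omega) hm hone]
  have hpow : (m : ℝ) ^ (n - 1) = m ^ (n - 2) * m := by
    rw [← pow_succ]; congr 1; omega
  rw [hpow]
  linarith

end Correlations

theorem mainTheorem5 (n m : ℕ) (hn : 3 ≤ n) (hm : 2 ≤ m) :
    (∀ P : (Fin n → Fin m) → (Fin n → Fin 2) → ℝ,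
      IsBiseparableCorrelation.{u, v} P →
      (m : ℝ) ^ (n - 2) * ((m : ℝ) - Real.cot (Real.pi / (2 * m))) ≤ bellOmega n m 2 P) ∧
    IsGreatest (trigObjective m '' {j : ℕ | j < m}) (Real.cot (Real.pi / (2 * m))) ∧
    trigObjective m 0 = Real.cot (Real.pi / (2 * m)) := by
  refine ⟨fun P hP => hP.bellOmega_ge hn hm, ⟨⟨0, ?_, trigObjective_zero hm⟩, ?_⟩,
    trigObjective_zero hm⟩
  · exact (by omega : 0 < m)
  · rintro _ ⟨j, -, rfl⟩
    exact trigObjective_le hm j
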